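/- Let $U:\mathbb R\to\mathbb R$ and $\hat u,\hat v:\mathbb R\to\mathbb C$ be twice continuously differentiable, $k\in\mathbb R$, $\omega=\omega_r+i\omega_i\in\mathbb C$, $t_0\in\mathbb R$, $T\ge 0$ and $\mathbf x_0=(x_0,y_0)\in\mathbb R^2$. Write $\hat u=\hat u_r+i\hat u_i$, $\hat v=\hat v_r+i\hat v_i$. Consider the planar velocity fields $$\mathbf u_\epsilon=\mathbf u_0+\epsilon\,\mathbf u',\qquad \mathbf u_0(x,y)=[U(y),0]^\top,\qquad \mathbf u'(x,y,t)=\operatorname{Re}\big([\hat u(y),\hat v(y)]^\top e^{i(kx-\omega t)}\big),$$ and let ${}_{\epsilon}\mathbf F_{t_0}^{t}$ be the flow map of $\mathbf u_\epsilon$ from time $t_0$ to time $t$. For all sufficiently small $\epsilon>0$ it is well defined, uniquely, in a neighbourhood of $\mathbf x_0$ (independent of $\epsilon$) for $t\in[t_0,t_0+T]$. The following holds as $\epsilon\to0^+$. **(a) Flow map.** ${}_0\mathbf F_{t_0}^{t}(\mathbf x_0)=\mathbf x_0+\mathbf u_0(\mathbf x_0)(t-t_0)$ for $t\in[t_0,t_0+T]$,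 and $${}_{\epsilon}\mathbf F_{t_0}^{t_0+T}(\mathbf x_0)={}_0\mathbf F_{t_0}^{t_0+T}(\mathbf x_0)+\epsilon\,\mathbf A_{t_0}^{t_0+T}(\mathbf x_0)+\mathcal O(\epsilon^2),$$ where $\mathbf A_{t_0}^{t}(\mathbf x_0)$, $t\in[t_0,t_0+T]$, is the unique solution of the initial value problem $$\tfrac{d}{dt}\mathbf A_{t_0}^{t}(\mathbf x_0)=\nabla\mathbf u_0\big({}_0\mathbf F_{t_0}^{t}(\mathbf x_0)\big)\mathbf A_{t_0}^{t}(\mathbf x_0)+\mathbf u'\big({}_0\mathbf F_{t_0}^{t}(\mathbf x_0),t\big),\qquad \mathbf A_{t_0}^{t_0}(\mathbf x_0)=\mathbf 0 .$$ **(b) Explicit solution.** Put $c=U(y_0)$, $\theta_0=kx_0-\omega_rt_0$, $\theta_1=kx_0-\omega_r(t_0+T)+kcT$, $E_0=e^{\omega_it_0}$, $E_1=e^{\omega_i(t_0+T)}$ and $g=\omega_i^2+\omega_r^2-2\omega_rkc+k^2c^2$ $(=(\omega_r-kc)^2+\omega_i^2)$. If $g\neq0$, then $$\mathbf A_{t_0}^{t_0+T}(\mathbf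 x_0)=\begin{bmatrix}\dfrac{f_1\hat u_r(y_0)+f_2\hat u_i(y_0)}{g}+\dfrac{f_3\hat v_r(y_0)U'(y_0)+f_4\hat v_i(y_0)U'(y_0)}{g^2}\\[2ex]\dfrac{f_5\hat v_r(y_0)+f_6\hat v_i(y_0)}{g}\end{bmatrix},$$ where $$f_1=f_5=-E_0\omega_i\cos\theta_0+E_0(\omega_r-kc)\sin\theta_0+E_1\omega_i\cos\theta_1-E_1(\omega_r-kc)\sin\theta_1,$$ $$f_2=f_6=E_0\omega_i\sin\theta_0+E_0(\omega_r-kc)\cos\theta_0-E_1\omega_i\sin\theta_1-E_1(\omega_r-kc)\cos\theta_1,$$ $$f_3=-E_0P\cos\theta_0+E_0Q\sin\theta_0+E_1S\cos\theta_1-E_1R\sin\theta_1,$$ $$f_4=E_0P\sin\theta_0+E_0Q\cos\theta_0-E_1S\sin\theta_1-E_1R\cos\theta_1,$$ with $$P=\omega_i^2+\omega_i^3T-\omega_r^2+\omega_i\omega_r^2T-k^2c^2+\omega_ik^2c^2T+2\omega_rkc-2\omega_i\omega_rkcT,$$ $$Q=2\omega_i\omega_r+\omega_i^2\omega_rT+\omega_r^3T-k^3c^3T+3\omega_rk^2c^2T-2\omega_ikc-\omega_i^2kcT-3\omega_r^2kcT,$$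 $$S=\omega_i^2-\omega_r^2-k^2c^2+2\omega_rkc,\qquad R=2\omega_i\omega_r-2\omega_ikc.$$ **(c) Curvature change.** The signed curvature of a plane curve $\mathbf r$ is $\langle\mathbf r'',\mathbf R\mathbf r'\rangle/\langle\mathbf r',\mathbf r'\rangle^{3/2}$ with $\mathbf R=\begin{bmatrix}0&1\\-1&0\end{bmatrix}$ (clockwise rotation). Let $\mathbf r$ be a material line that at time $t_0$ passes through $\mathbf x_0$ at the parameter $s_0$, is twice continuously differentiable near $s_0$, and has tangent $\mathbf r'(s_0)=[1,0]^\top$ and curvature $0$ there. For all sufficiently small $\epsilon>0$ the advected line ${}_{\epsilon}\mathbf F_{t_0}^{t_0+T}\circ\mathbf r$ is twice continuously differentiable at $s_0$ with non-vanishing tangent; and if $g\ne0$, the curvature change $\bar\kappa_{t_0}^{t_0+T}(\mathbf x_0)$ (the curvature of the advected line minus that of the initial line, both at $s_0$) satisfies $$\begin{aligned}\bar\kappa_{t_0}^{t_0+T}(\mathbf x_0)=\frac{\epsilon\,k^2}{\omega_i^2+\omega_r^2-2\omega_rkc+k^2c^2}\Big[&e^{\omega_it_0}\Big(\big(-\omega_i\hat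 v_r(y_0)+(\omega_r-kc)\hat v_i(y_0)\big)\cos\theta_0+\big(\omega_i\hat v_i(y_0)+(\omega_r-kc)\hat v_r(y_0)\big)\sin\theta_0\Big)\\&+e^{\omega_i(t_0+T)}\Big(\big(\omega_i\hat v_r(y_0)-(\omega_r-kc)\hat v_i(y_0)\big)\cos\theta_1-\big(\omega_i\hat v_i(y_0)+(\omega_r-kc)\hat v_r(y_0)\big)\sin\theta_1\Big)\Big]+\mathcal O(\epsilon^2).\end{aligned}$$ -/

import Mathlib

open Set Filter Topology Asymptotics

noncomputable section

namespace ShearFlow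

/-- The plane of positions `(x, y)`: `p 0` is the stream-wise coordinate `x`, `p 1` is `y`. -/
abbrev Plane := EuclideanSpace ℝ (Fin 2)

/-- The clockwise rotation by ninety degrees, with matrix `[[0, 1], [-1, 0]]`. -/
def rot (v : Plane) : Plane := !₂[v 1, -v 0]

/-- The signed curvature `⟨r'', R r'⟩ / √⟨r', r'⟩ ^ 3` of a parametrized plane curve. -/
def curvature (r : ℝ → Plane) (s : ℝ) : ℝ :=
  inner ℝ (deriv (deriv r) s) (rot (deriv r s)) / Real.sqrt (inner ℝ (deriv r s) (deriv r s)) ^ 3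

/-- The change of the curvature of the curve `r` at the parameter `s` when `r` is advected
by the map `F`. -/
def curvatureChange (F : Plane → Plane) (r : ℝ → Plane) (s : ℝ) : ℝ :=
  curvature (F ∘ r) s - curvature r s

/-- `γ` is a trajectory on `[t₀, t₁]` of the time-dependent velocity field `u`, released from
`x` at time `t₀`. -/
def IsTrajectory (u : ℝ → Plane → Plane) (t₀ t₁ : ℝ) (x : Plane) (γ : ℝ → Plane) : Prop :=
  γ t₀ = x ∧ IsIntegralCurveOn γ u (Icc t₀ t₁)

open Classical in
/-- The flow map of `u` from time `t₀` to time `t`: the position at time `t` of the particle that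
is at `x` at time `t₀`. (Where there is no trajectory on `[t₀, t]`, the value is `x`.) -/
def flowMap (u : ℝ → Plane → Plane) (t₀ t : ℝ) (x : Plane) : Plane :=
  if h : ∃ γ : ℝ → Plane, IsTrajectory u t₀ t x γ then h.choose t else x

/-- The parallel base flow `[U(y), 0]`. -/
def baseVelocity (U : ℝ → ℝ) (_t : ℝ) (p : Plane) : Plane := !₂[U (p 1), 0]

/-- The normal mode `Re ([û(y), v̂(y)] e^{i(kx - ωt)})`. -/
def modeVelocity (uhat vhat : ℝ → ℂ) (k : ℝ) (ω : ℂ) (t : ℝ) (p : Plane) : Plane :=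
  !₂[(uhat (p 1) * Complex.exp (Complex.I * ((k : ℂ) * (p 0 : ℂ) - ω * (t : ℂ)))).re,
     (vhat (p 1) * Complex.exp (Complex.I * ((k : ℂ) * (p 0 : ℂ) - ω * (t : ℂ)))).re]

/-- The perturbed velocity field `u₀ + ε u'`. -/
def perturbedVelocity (U : ℝ → ℝ) (uhat vhat : ℝ → ℂ) (k : ℝ) (ω : ℂ) (ε t : ℝ) (p : Plane) :
    Plane :=
  baseVelocity U t p + ε • modeVelocity uhat vhat k ω t p

/-- `A` solves on `[t₀, t₁]` the linear initial value problem
`A' = ∇u₀(₀F) A + u'(₀F, t)`, `A(t₀) = 0`, where `₀F` is the base trajectory of `x₀`. -/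
def SolvesResponseIVP (U : ℝ → ℝ) (uhat vhat : ℝ → ℂ) (k : ℝ) (ω : ℂ) (t₀ t₁ : ℝ) (x₀ : Plane)
    (A : ℝ → Plane) : Prop :=
  A t₀ = 0 ∧
  IsIntegralCurveOn A
    (fun t a => fderiv ℝ (baseVelocity U t) (flowMap (baseVelocity U) t₀ t x₀) a
      + modeVelocity uhat vhat k ω t (flowMap (baseVelocity U) t₀ t x₀))
    (Icc t₀ t₁)

/-! The coefficient functions of the explicit solution. Here `a` and `b` are the real and the
imaginary part of the frequency, `x` is the initial stream-wise position, and `c` is the base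
velocity at the initial cross-stream position. -/

def f₁ (k a b t₀ T x c : ℝ) : ℝ :=
  -Real.exp (b * t₀) * b * Real.cos (k * x - a * t₀)
  + Real.exp (b * t₀) * (a - k * c) * Real.sin (k * x - a * t₀)
  + Real.exp (b * (t₀ + T)) * b * Real.cos (k * x - a * (t₀ + T) + k * c * T)
  - Real.exp (b * (t₀ + T)) * (a - k * c) * Real.sin (k * x - a * (t₀ + T) + k * c * T)

def f₂ (k a b t₀ T x c : ℝ) : ℝ :=
  Real.exp (b * t₀) * b * Real.sin (k * x - a * t₀)
  + Real.exp (b * t₀) * (a - k * c) * Real.cos (k * x - a * t₀)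
  - Real.exp (b * (t₀ + T)) * b * Real.sin (k * x - a * (t₀ + T) + k * c * T)
  - Real.exp (b * (t₀ + T)) * (a - k * c) * Real.cos (k * x - a * (t₀ + T) + k * c * T)

def f₃ (k a b t₀ T x c : ℝ) : ℝ :=
  -Real.exp (b * t₀) * (b ^ 2 + b ^ 3 * T - a ^ 2 + b * a ^ 2 * T - k ^ 2 * c ^ 2
      + b * k ^ 2 * c ^ 2 * T + 2 * a * k * c - 2 * b * a * k * c * T)
    * Real.cos (k * x - a * t₀)
  + Real.exp (b * t₀) * (2 * b * a + b ^ 2 * a * T + a ^ 3 * T - k ^ 3 * c ^ 3 * T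
      + 3 * a * k ^ 2 * c ^ 2 * T - 2 * b * k * c - b ^ 2 * k * c * T - 3 * a ^ 2 * k * c * T)
    * Real.sin (k * x - a * t₀)
  + Real.exp (b * (t₀ + T)) * (b ^ 2 - a ^ 2 - k ^ 2 * c ^ 2 + 2 * a * k * c)
    * Real.cos (k * x - a * (t₀ + T) + k * c * T)
  - Real.exp (b * (t₀ + T)) * (2 * b * a - 2 * b * k * c)
    * Real.sin (k * x - a * (t₀ + T) + k * c * T)

def f₄ (k a b t₀ T x c : ℝ) : ℝ :=
  Real.exp (b * t₀) * (b ^ 2 + b ^ 3 * T - a ^ 2 + b * a ^ 2 * T - k ^ 2 * c ^ 2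
      + b * k ^ 2 * c ^ 2 * T + 2 * a * k * c - 2 * b * a * k * c * T)
    * Real.sin (k * x - a * t₀)
  + Real.exp (b * t₀) * (2 * b * a + b ^ 2 * a * T + a ^ 3 * T - k ^ 3 * c ^ 3 * T
      + 3 * a * k ^ 2 * c ^ 2 * T - 2 * b * k * c - b ^ 2 * k * c * T - 3 * a ^ 2 * k * c * T)
    * Real.cos (k * x - a * t₀)
  - Real.exp (b * (t₀ + T)) * (b ^ 2 - a ^ 2 - k ^ 2 * c ^ 2 + 2 * a * k * c)
    * Real.sin (k * x - a * (t₀ + T) + k * c * T)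
  - Real.exp (b * (t₀ + T)) * (2 * b * a - 2 * b * k * c)
    * Real.cos (k * x - a * (t₀ + T) + k * c * T)

def f₅ (k a b t₀ T x c : ℝ) : ℝ :=
  -Real.exp (b * t₀) * b * Real.cos (k * x - a * t₀)
  + Real.exp (b * t₀) * (a - k * c) * Real.sin (k * x - a * t₀)
  + Real.exp (b * (t₀ + T)) * b * Real.cos (k * x - a * (t₀ + T) + k * c * T)
  - Real.exp (b * (t₀ + T)) * (a - k * c) * Real.sin (k * x - a * (t₀ + T) + k * c * T)

def f₆ (k a b t₀ T x c : ℝ) : ℝ :=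
  Real.exp (b * t₀) * b * Real.sin (k * x - a * t₀)
  + Real.exp (b * t₀) * (a - k * c) * Real.cos (k * x - a * t₀)
  - Real.exp (b * (t₀ + T)) * b * Real.sin (k * x - a * (t₀ + T) + k * c * T)
  - Real.exp (b * (t₀ + T)) * (a - k * c) * Real.cos (k * x - a * (t₀ + T) + k * c * T)

def g (k a b c : ℝ) : ℝ := b ^ 2 + a ^ 2 - 2 * a * k * c + k ^ 2 * c ^ 2

/-- The explicit value at time `t₀ + T` of the first-order displacement. -/
def explicitResponse (U : ℝ → ℝ) (uhat vhat : ℝ → ℂ) (k : ℝ) (ω : ℂ) (t₀ T : ℝ) (x₀ : Plane) :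
    Plane :=
  let a := ω.re
  let b := ω.im
  let x := x₀ 0
  let y := x₀ 1
  let c := U y
  !₂[(f₁ k a b t₀ T x c * (uhat y).re + f₂ k a b t₀ T x c * (uhat y).im) / g k a b c
      + (f₃ k a b t₀ T x c * (vhat y).re * deriv U y
          + f₄ k a b t₀ T x c * (vhat y).im * deriv U y) / g k a b c ^ 2,
     (f₅ k a b t₀ T x c * (vhat y).re + f₆ k a b t₀ T x c * (vhat y).im) / g k a b c]

/-- The coefficient of `ε` in the finite-time curvature change of a stream-wise material line.
The arguments are: wave number `k`, frequency `ω`, initial time `t₀`, duration `T`, initial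
stream-wise position `x`, base velocity `c` and lateral amplitude `w` at the initial position. -/
def curvatureRate (k : ℝ) (ω : ℂ) (t₀ T x c : ℝ) (w : ℂ) : ℝ :=
  let a := ω.re
  let b := ω.im
  k ^ 2 / (b ^ 2 + a ^ 2 - 2 * a * k * c + k ^ 2 * c ^ 2) *
    (Real.exp (b * t₀) *
        ((-b * w.re + (a - k * c) * w.im) * Real.cos (k * x - a * t₀)
          + (b * w.im + (a - k * c) * w.re) * Real.sin (k * x - a * t₀))
      + Real.exp (b * (t₀ + T)) *
        ((b * w.re - (a - k * c) * w.im) * Real.cos (k * x - a * (t₀ + T) + k * c * T)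
          - (b * w.im + (a - k * c) * w.re) * Real.sin (k * x - a * (t₀ + T) + k * c * T)))

end ShearFlow

end

open ShearFlow

/-!
The proof treats whole trajectories as points of the Banach algebra `C([t₀, t₀ + T], ℝ)`.

A trajectory `(X, Y)` of the perturbed flow with initial position `p` solves the integral equations
`X = p₀ + ∫ U(Y) + ε ∫ Re Û` and `Y = p₁ + ε ∫ Re V`, where `Û` and `V` are the complex normal modes
along `(X, Y)`. In the unknowns `W = X - ∫ U(Y)` and `Y` this is a small perturbation of the
identity, `(W, Y) = p + ε Φ(W, Y)`. Superposition operators of `C²` functions are `C²` between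
spaces of continuous functions (`contDiff_postcomp`), so `Φ` is `C²` and the inverse function theorem
gives a solution that is `C²` in `(ε, p)` and defined on the whole time interval
(`exists_contDiffAt_fixedPoint`, `exists_contDiffAt_motion`). Gronwall's inequality identifies it
with the flow map.

The expansion of the flow map is then Taylor's formula in `ε`; differentiating the integral equations
at `ε = 0` shows that the linear coefficient solves the response problem
(`solvesResponseIVP_deriv`). The closed formula solves the same linear problem, whose solution is
unique.

For the curvature, the integral equations are differentiated twice in the parameter `s` of the
material line. As `v̂''` is merely continuous, continuity of the second derivatives alone would give
an error `o(ε)`. The error is `O(ε²)` (`isBigO_family`) because `v̂''` enters `∂²V` only with the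
factor `(∂Y)²`, and `∂Y = O(ε)`. To leading order `∂V = ikV₀` and `∂²V = (ikα - k²) V₀`, where `α`
is the tangential acceleration of the parametrization, and in the curvature the terms with `α`
cancel (`isBigO_curvature`): what remains is `k²` times the lateral component of the response.
-/

universe u v

namespace ShearFlow

/-! ### Superposition operators on spaces of continuous functions -/

section Superposition

/-- Stated for an abstract target `F`: for a space of operators, the operator-norm topology and the
topology used by the API of continuous maps agree only up to unfolding. -/
lemma continuous_norm_postcomp_sub {K : Type v} [TopologicalSpace K] [CompactSpace K]
    {E F : Type u} [TopologicalSpace E] [NormedAddCommGroup F] (f : C(E, F)) (γ : C(K, E)) :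
    Continuous fun γ' : C(K, E) => ‖f.comp γ' - f.comp γ‖ :=
  (f.continuous_postcomp.sub continuous_const).norm

variable {K : Type v} [TopologicalSpace K] [CompactSpace K] {E F : Type u}
  [NormedAddCommGroup E] [NormedSpace ℝ E] [NormedAddCommGroup F] [NormedSpace ℝ F]

/-- The bounded bilinear map `(L, h) ↦ (t ↦ L t (h t))`. -/
noncomputable def pointwiseApply : C(K, E →L[ℝ] F) →L[ℝ] C(K, E) →L[ℝ] C(K, F) :=
  LinearMap.mkContinuous₂
    (LinearMap.mk₂ ℝ (fun (L : C(K, E →L[ℝ] F)) (h : C(K, E)) =>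
        (⟨fun t => L t (h t), by fun_prop⟩ : C(K, F)))
      (fun _ _ _ => by ext; simp) (fun _ _ _ => by ext; simp)
      (fun _ _ _ => by ext; simp) (fun _ _ _ => by ext; simp))
    1 (fun L h => by
      rw [one_mul, ContinuousMap.norm_le _ (by positivity)]
      intro t
      exact ((L t).le_opNorm _).trans
        (mul_le_mul (L.norm_coe_le_norm t) (h.norm_coe_le_norm t) (norm_nonneg _) (by positivity)))

@[simp]
lemma pointwiseApply_apply (L : C(K, E →L[ℝ] F)) (h : C(K, E)) (t : K) :
    pointwiseApply L h t = L t (h t) := rfl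

/-- The superposition operator of a `C¹` map is differentiable. Its derivative at `γ` is
pointwise application of `f' ∘ γ`; the required uniformity in `t` is the continuity of the
superposition operator of `f'`. -/
lemma hasFDerivAt_postcomp (f : C(E, F)) (f' : C(E, E →L[ℝ] F))
    (hf : ∀ x, HasFDerivAt f (f' x) x) (γ : C(K, E)) :
    HasFDerivAt (fun γ : C(K, E) => f.comp γ) (pointwiseApply (f'.comp γ)) γ := by
  rw [hasFDerivAt_iff_isLittleO, isLittleO_iff]
  intro c hc
  have hcont : Continuous fun γ' : C(K, E) => ‖f'.comp γ' - f'.comp γ‖ :=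
    continuous_norm_postcomp_sub f' γ
  obtain ⟨δ, hδ, hball⟩ := Metric.eventually_nhds_iff.1
    ((hcont.tendsto γ).eventually_lt_const (u := c) (by
      rw [sub_self]; exact (norm_zero (E := C(K, E →L[ℝ] F))).trans_lt hc))
  filter_upwards [Metric.ball_mem_nhds γ hδ] with γ' hγ'
  rw [ContinuousMap.norm_le _ (by positivity)]
  intro t
  have hseg : ∀ x ∈ segment ℝ (γ t) (γ' t), ‖f' x - f' (γ t)‖ ≤ c := by
    intro x hx
    rw [segment_eq_image'] at hx
    obtain ⟨τ, hτ, rfl⟩ := hx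
    have hmem : dist (γ + τ • (γ' - γ)) γ < δ := by
      rw [dist_eq_norm, add_sub_cancel_left, norm_smul, Real.norm_of_nonneg hτ.1]
      rw [Metric.mem_ball, dist_eq_norm] at hγ'
      exact (mul_le_of_le_one_left (norm_nonneg _) hτ.2).trans_lt hγ'
    exact ((f'.comp (γ + τ • (γ' - γ)) - f'.comp γ).norm_coe_le_norm t).trans (hball hmem).le
  have := (convex_segment (γ t) (γ' t)).norm_image_sub_le_of_norm_hasFDerivWithin_le'
    (fun x _ => (hf x).hasFDerivWithinAt) hseg (left_mem_segment ℝ _ _) (right_mem_segment ℝ _ _)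
  exact this.trans (mul_le_mul_of_nonneg_left ((γ' - γ).norm_coe_le_norm t) hc.le)

/-- Both spaces lie in one universe because the induction replaces `F` by `E →L[ℝ] F`. -/
lemma contDiff_postcomp {n : ℕ} (f : C(E, F)) (hf : ContDiff ℝ n f) :
    ContDiff ℝ n (fun γ : C(K, E) => f.comp γ) := by
  induction n generalizing F with
  | zero => exact contDiff_zero.2 f.continuous_postcomp
  | succ n ih =>
    obtain ⟨f', hf', hd⟩ := contDiff_succ_iff_hasFDerivAt.1 hf
    exact contDiff_succ_iff_hasFDerivAt.2
      ⟨_, pointwiseApply.contDiff.comp (ih ⟨f', hf'.continuous⟩ hf'),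
        hasFDerivAt_postcomp f ⟨f', hf'.continuous⟩ hd⟩

end Superposition

/-! ### Small perturbations of the identity -/

/-- A `C²` map `Φ` of a Banach space has a `C²` family of solutions of `w = z + ε Φ(w)` near
`ε = 0`. -/
lemma exists_contDiffAt_fixedPoint {Z : Type*} [NormedAddCommGroup Z] [NormedSpace ℝ Z]
    [CompleteSpace Z] {Φ : Z → Z} (hΦ : ContDiff ℝ 2 Φ) (z₀ : Z) :
    ∃ S : ℝ × Z → Z, ContDiffAt ℝ 2 S (0, z₀) ∧ S (0, z₀) = z₀ ∧
      ∀ᶠ q in 𝓝 ((0 : ℝ), z₀), S q = q.2 + q.1 • Φ (S q) := by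
  let Ψ : ℝ × Z → ℝ × Z := fun q => (q.1, q.2 - q.1 • Φ q.2)
  have hΨ : ContDiff ℝ 2 Ψ := by fun_prop
  let L : (ℝ × Z) ≃L[ℝ] ℝ × Z := ContinuousLinearEquiv.equivOfInverse
    ((ContinuousLinearMap.fst ℝ ℝ Z).prod (ContinuousLinearMap.snd ℝ ℝ Z -
      (ContinuousLinearMap.fst ℝ ℝ Z).smulRight (Φ z₀)))
    ((ContinuousLinearMap.fst ℝ ℝ Z).prod (ContinuousLinearMap.snd ℝ ℝ Z +
      (ContinuousLinearMap.fst ℝ ℝ Z).smulRight (Φ z₀)))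
    (fun _ => by simp) (fun _ => by simp)
  have hL : HasFDerivAt Ψ (L : (ℝ × Z) →L[ℝ] ℝ × Z) (0, z₀) := by
    have h2 : HasFDerivAt (fun q : ℝ × Z => Φ q.2)
        ((fderiv ℝ Φ z₀).comp (ContinuousLinearMap.snd ℝ ℝ Z)) (0, z₀) :=
      HasFDerivAt.comp (f := Prod.snd) (0, z₀)
        ((hΦ.differentiable (by norm_num)) z₀).hasFDerivAt hasFDerivAt_snd
    have h1 := hasFDerivAt_fst.prodMk (hasFDerivAt_snd.sub (hasFDerivAt_fst.smul h2))
    refine h1.congr_fderiv ?_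
    ext q <;> simp [L]
  have hA : ContDiffAt ℝ 2 Ψ (0, z₀) := hΨ.contDiffAt
  have hne : (2 : WithTop ℕ∞) ≠ 0 := by norm_num
  have hΨ0 : Ψ (0, z₀) = (0, z₀) := by simp [Ψ]
  have hstrict := hA.hasStrictFDerivAt' hL hne
  have hinv := hA.to_localInverse hL hne
  have hright := hstrict.eventually_right_inverse
  have himg := hstrict.localInverse_apply_image
  rw [hΨ0] at hinv hright himg
  refine ⟨fun q => (hA.localInverse hL hne q).2, contDiff_snd.contDiffAt.comp _ hinv,
    congrArg Prod.snd himg, ?_⟩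
  filter_upwards [hright] with q hq
  change Ψ (hA.localInverse hL hne q) = q at hq
  have e1 : (hA.localInverse hL hne q).1 = q.1 := by
    simpa [Ψ] using congrArg Prod.fst hq
  have e2 : (hA.localInverse hL hne q).2 - (hA.localInverse hL hne q).1 •
    Φ (hA.localInverse hL hne q).2 = q.2 := by
    simpa [Ψ] using congrArg Prod.snd hq
  rw [e1] at e2
  exact sub_eq_iff_eq_add.1 e2

/-! ### Trajectories and the flow map -/

lemma IsTrajectory.mono {u : ℝ → Plane → Plane} {t₀ t t₁ : ℝ} {x : Plane} {γ : ℝ → Plane}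
    (h : IsTrajectory u t₀ t₁ x γ) (ht : t ≤ t₁) : IsTrajectory u t₀ t x γ :=
  ⟨h.1, h.2.mono (Icc_subset_Icc_right ht)⟩

/-- Two integral curves stay in a common ball, so Lipschitz bounds on balls, uniform in time,
suffice for uniqueness. -/
lemma eqOn_Icc_of_isIntegralCurveOn {u : ℝ → Plane → Plane} {t₀ t₁ : ℝ}
    (hu : ∀ R : ℝ, ∃ K, ∀ t ∈ Icc t₀ t₁, LipschitzOnWith K (u t) (Metric.closedBall 0 R))
    {γ η : ℝ → Plane} (hγ : IsIntegralCurveOn γ u (Icc t₀ t₁))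
    (hη : IsIntegralCurveOn η u (Icc t₀ t₁)) (h0 : γ t₀ = η t₀) : EqOn γ η (Icc t₀ t₁) := by
  obtain ⟨R₁, h₁⟩ := isCompact_Icc.exists_bound_of_continuousOn hγ.continuousOn
  obtain ⟨R₂, h₂⟩ := isCompact_Icc.exists_bound_of_continuousOn hη.continuousOn
  obtain ⟨K, hK⟩ := hu (max R₁ R₂)
  have key : ∀ ζ : ℝ → Plane, IsIntegralCurveOn ζ u (Icc t₀ t₁) → ∀ t ∈ Ico t₀ t₁,
      HasDerivWithinAt ζ (u t (ζ t)) (Ici t) t := fun ζ hζ t ht =>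
    ((hζ t (Ico_subset_Icc_self ht)).mono (Icc_subset_Icc_left ht.1)).mono_of_mem_nhdsWithin
      (Icc_mem_nhdsGE ht.2)
  exact ODE_solution_unique_of_mem_Icc_right (s := fun _ => Metric.closedBall 0 (max R₁ R₂))
    (fun t ht => hK t (Ico_subset_Icc_self ht)) hγ.continuousOn (key γ hγ)
    (fun t ht => mem_closedBall_zero_iff.2
      ((h₁ t (Ico_subset_Icc_self ht)).trans (le_max_left _ _)))
    hη.continuousOn (key η hη)
    (fun t ht => mem_closedBall_zero_iff.2
      ((h₂ t (Ico_subset_Icc_self ht)).trans (le_max_right _ _))) h0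

lemma exists_lipschitzOnWith_closedBall {u : ℝ → Plane → Plane}
    (hu : ContDiff ℝ 1 (Function.uncurry u)) (t₀ t₁ R : ℝ) :
    ∃ K, ∀ t ∈ Icc t₀ t₁, LipschitzOnWith K (u t) (Metric.closedBall 0 R) := by
  obtain ⟨K, hK⟩ := hu.locallyLipschitz.locallyLipschitzOn.exists_lipschitzOnWith_of_compact
    ((isCompact_Icc (a := t₀) (b := t₁)).prod (isCompact_closedBall (0 : Plane) R))
  refine ⟨K, fun t ht p hp q hq => ?_⟩
  simpa [Prod.edist_eq] using hK (x := (t, p)) ⟨ht, hp⟩ (y := (t, q)) ⟨ht, hq⟩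

lemma IsTrajectory.eqOn {u : ℝ → Plane → Plane} (hu : ContDiff ℝ 1 (Function.uncurry u))
    {t₀ t₁ : ℝ} {x : Plane} {γ η : ℝ → Plane} (hγ : IsTrajectory u t₀ t₁ x γ)
    (hη : IsTrajectory u t₀ t₁ x η) : EqOn γ η (Icc t₀ t₁) :=
  eqOn_Icc_of_isIntegralCurveOn (exists_lipschitzOnWith_closedBall hu t₀ t₁) hγ.2 hη.2
    (hγ.1.trans hη.1.symm)

lemma IsTrajectory.flowMap_eq {u : ℝ → Plane → Plane} (hu : ContDiff ℝ 1 (Function.uncurry u))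
    {t₀ t₁ : ℝ} {x : Plane} {γ : ℝ → Plane} (hγ : IsTrajectory u t₀ t₁ x γ) {t : ℝ}
    (ht : t ∈ Icc t₀ t₁) : flowMap u t₀ t x = γ t := by
  have h : ∃ γ : ℝ → Plane, IsTrajectory u t₀ t x γ := ⟨γ, hγ.mono ht.2⟩
  rw [flowMap, dif_pos h]
  exact h.choose_spec.eqOn hu (hγ.mono ht.2) (right_mem_Icc.2 ht.1)

lemma IsTrajectory.isTrajectory_flowMap {u : ℝ → Plane → Plane}
    (hu : ContDiff ℝ 1 (Function.uncurry u)) {t₀ t₁ : ℝ} (h01 : t₀ ≤ t₁) {x : Plane}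
    {γ : ℝ → Plane} (hγ : IsTrajectory u t₀ t₁ x γ) :
    IsTrajectory u t₀ t₁ x (fun t => flowMap u t₀ t x) := by
  refine ⟨(hγ.flowMap_eq hu (left_mem_Icc.2 h01)).trans hγ.1, fun t ht => ?_⟩
  have := (hγ.2 t ht).congr (fun s hs => hγ.flowMap_eq hu hs) (hγ.flowMap_eq hu ht)
  simpa only [hγ.flowMap_eq hu ht] using this

/-! ### Velocity fields -/

lemma contDiff_plane {E : Type*} [NormedAddCommGroup E] [NormedSpace ℝ E] {n : WithTop ℕ∞}
    {f g : E → ℝ} (hf : ContDiff ℝ n f) (hg : ContDiff ℝ n g) :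
    ContDiff ℝ n (fun e => (!₂[f e, g e] : Plane)) := by
  rw [contDiff_euclidean]
  intro i
  fin_cases i
  · simpa using hf
  · simpa using hg

lemma contDiff_perturbedVelocity {U : ℝ → ℝ} {uhat vhat : ℝ → ℂ} (k : ℝ) (ω : ℂ) {n : WithTop ℕ∞}
    (hU : ContDiff ℝ n U) (hu : ContDiff ℝ n uhat) (hv : ContDiff ℝ n vhat) (ε : ℝ) :
    ContDiff ℝ n (Function.uncurry (perturbedVelocity U uhat vhat k ω ε)) := by
  have h0 : ContDiff ℝ n fun q : ℝ × Plane => q.2 0 := by fun_prop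
  have h1 : ContDiff ℝ n fun q : ℝ × Plane => q.2 1 := by fun_prop
  have hexp : ContDiff ℝ n fun q : ℝ × Plane =>
      Complex.exp (Complex.I * ((k : ℂ) * (q.2 0 : ℂ) - ω * (q.1 : ℂ))) := by
    have h0' : ContDiff ℝ n fun q : ℝ × Plane => (q.2 0 : ℂ) := Complex.ofRealCLM.contDiff.comp h0
    have ht : ContDiff ℝ n fun q : ℝ × Plane => (q.1 : ℂ) :=
      Complex.ofRealCLM.contDiff.comp contDiff_fst
    fun_prop
  have hmode : ∀ w : ℝ → ℂ, ContDiff ℝ n w → ContDiff ℝ n fun q : ℝ × Plane =>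
      (w (q.2 1) * Complex.exp (Complex.I * ((k : ℂ) * (q.2 0 : ℂ) - ω * (q.1 : ℂ)))).re :=
    fun w hw => Complex.reCLM.contDiff.comp ((hw.comp h1).mul hexp)
  exact (contDiff_plane (hU.comp h1) contDiff_const).add
    ((contDiff_plane (hmode _ hu) (hmode _ hv)).const_smul ε)

lemma hasDerivWithinAt_plane {f g : ℝ → ℝ} {f' g' t : ℝ} {s : Set ℝ}
    (hf : HasDerivWithinAt f f' s t) (hg : HasDerivWithinAt g g' s t) :
    HasDerivWithinAt (fun t => (!₂[f t, g t] : Plane)) !₂[f', g'] s t := by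
  have h : HasDerivWithinAt (fun t => ![f t, g t]) ![f', g'] s t := by
    rw [hasDerivWithinAt_pi]
    intro i
    fin_cases i
    · simpa using hf
    · simpa using hg
  exact (EuclideanSpace.equiv (Fin 2) ℝ).symm.toContinuousLinearMap.hasFDerivAt.comp_hasDerivWithinAt
    t h

lemma perturbedVelocity_zero (U : ℝ → ℝ) (uhat vhat : ℝ → ℂ) (k : ℝ) (ω : ℂ) :
    perturbedVelocity U uhat vhat k ω 0 = baseVelocity U := by
  ext t p i
  simp [perturbedVelocity]

lemma flowMap_baseVelocity {U : ℝ → ℝ} (hU : ContDiff ℝ 1 U) (x₀ : Plane) {t₀ t : ℝ}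
    (ht : t₀ ≤ t) :
    flowMap (baseVelocity U) t₀ t x₀ = x₀ + (t - t₀) • baseVelocity U t₀ x₀ := by
  have hu : ContDiff ℝ 1 (Function.uncurry (baseVelocity U)) := by
    rw [← perturbedVelocity_zero U 0 0 0 0]
    exact contDiff_perturbedVelocity 0 0 hU contDiff_const contDiff_const 0
  refine IsTrajectory.flowMap_eq (t₁ := t)
    (γ := fun t => x₀ + (t - t₀) • baseVelocity U t₀ x₀) hu ⟨by simp, fun s _ => ?_⟩
    (right_mem_Icc.2 ht)
  have : HasDerivAt (fun t => x₀ + (t - t₀) • baseVelocity U t₀ x₀)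
      ((1 : ℝ) • baseVelocity U t₀ x₀) s :=
    (((hasDerivAt_id s).sub_const t₀).smul_const _).const_add _
  convert this.hasDerivWithinAt using 1
  simp [baseVelocity]

/-! ### The integral equations of the perturbed trajectories -/

section Integral

variable {t₀ t₁ : ℝ}

/-- The Volterra operator `f ↦ (t ↦ ∫ s in t₀..t, f s)` on `C([t₀, t₁], ℝ)`. -/
noncomputable def primitive (h : t₀ ≤ t₁) : C(Icc t₀ t₁, ℝ) →L[ℝ] C(Icc t₀ t₁, ℝ) :=
  have hint : ∀ (f : C(Icc t₀ t₁, ℝ)) (a b : ℝ),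
      IntervalIntegrable (fun s => f (projIcc t₀ t₁ h s)) MeasureTheory.volume a b :=
    fun f a b => (f.continuous.comp continuous_projIcc).intervalIntegrable a b
  LinearMap.mkContinuous
    { toFun := fun f => ⟨fun t => ∫ s in t₀..t, f (projIcc t₀ t₁ h s),
        (intervalIntegral.continuous_primitive (hint f) t₀).comp continuous_subtype_val⟩
      map_add' := fun f f' => by
        ext t
        exact intervalIntegral.integral_add (hint f _ _) (hint f' _ _)
      map_smul' := fun c f => by
        ext t
        exact intervalIntegral.integral_smul c _ }
    (t₁ - t₀) (fun f => by
      rw [ContinuousMap.norm_le _ (mul_nonneg (sub_nonneg.2 h) (norm_nonneg _))]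
      intro t
      refine (intervalIntegral.norm_integral_le_of_norm_le_const
        (fun s _ => f.norm_coe_le_norm (projIcc t₀ t₁ h s))).trans ?_
      rw [mul_comm, abs_of_nonneg (sub_nonneg.2 t.2.1)]
      exact mul_le_mul_of_nonneg_right (sub_le_sub_right t.2.2 _) (norm_nonneg _))

lemma primitive_apply (h : t₀ ≤ t₁) (f : C(Icc t₀ t₁, ℝ)) (t : Icc t₀ t₁) :
    primitive h f t = ∫ s in t₀..t, f (projIcc t₀ t₁ h s) := rfl

lemma primitive_apply_left (h : t₀ ≤ t₁) (f : C(Icc t₀ t₁, ℝ)) :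
    primitive h f ⟨t₀, left_mem_Icc.2 h⟩ = 0 := by
  rw [primitive_apply, intervalIntegral.integral_same]

lemma hasDerivWithinAt_primitive (h : t₀ ≤ t₁) (f : C(Icc t₀ t₁, ℝ)) {t : ℝ}
    (ht : t ∈ Icc t₀ t₁) :
    HasDerivWithinAt (fun t => primitive h f (projIcc t₀ t₁ h t)) (f (projIcc t₀ t₁ h t))
      (Icc t₀ t₁) t := by
  have hc : Continuous fun s => f (projIcc t₀ t₁ h s) := f.continuous.comp continuous_projIcc
  have := (hc.integral_hasStrictDerivAt t₀ t).hasDerivAt.hasDerivWithinAt (s := Icc t₀ t₁)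
  refine this.congr_of_mem (fun s hs => ?_) ht
  rw [primitive_apply, projIcc_of_mem h hs]

/-- The pointwise real part. -/
noncomputable def reC : C(Icc t₀ t₁, ℂ) →L[ℝ] C(Icc t₀ t₁, ℝ) :=
  Complex.reCLM.compLeftContinuous ℝ _

@[simp]
lemma reC_apply (f : C(Icc t₀ t₁, ℂ)) (t : Icc t₀ t₁) : reC f t = (f t).re := rfl

/-- The inclusion of the real-valued into the complex-valued functions. -/
noncomputable def toC : C(Icc t₀ t₁, ℝ) →L[ℝ] C(Icc t₀ t₁, ℂ) :=
  Complex.ofRealCLM.compLeftContinuous ℝ _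

@[simp]
lemma toC_apply (f : C(Icc t₀ t₁, ℝ)) (t : Icc t₀ t₁) : toC f t = (f t : ℂ) := rfl

/-- The carrier wave `e^{i(kX - ωt)}` along a stream-wise motion `X`. -/
noncomputable def wave (k : ℝ) (ω : ℂ) (X : C(Icc t₀ t₁, ℝ)) : C(Icc t₀ t₁, ℂ) :=
  ⟨fun t => Complex.exp (Complex.I * ((k : ℂ) * (X t : ℂ) - ω * ((t : ℝ) : ℂ))), by fun_prop⟩

lemma wave_apply (k : ℝ) (ω : ℂ) (X : C(Icc t₀ t₁, ℝ)) (t : Icc t₀ t₁) :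
    wave k ω X t = Complex.exp (Complex.I * ((k : ℂ) * (X t : ℂ) - ω * ((t : ℝ) : ℂ))) := rfl

lemma wave_eq_exp_comp (k : ℝ) (ω : ℂ) (X : C(Icc t₀ t₁, ℝ)) :
    wave k ω X = (⟨Complex.exp, Complex.continuous_exp⟩ : C(ℂ, ℂ)).comp ((Complex.I * k) • toC X
      - (⟨fun t => Complex.I * (ω * ((t : ℝ) : ℂ)), by fun_prop⟩ : C(Icc t₀ t₁, ℂ))) := by
  ext t
  simp [wave_apply, mul_sub, mul_assoc]

lemma contDiff_wave (k : ℝ) (ω : ℂ) {n : ℕ} :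
    ContDiff ℝ n (wave k ω : C(Icc t₀ t₁, ℝ) → C(Icc t₀ t₁, ℂ)) := by
  simp_rw [funext (wave_eq_exp_comp k ω)]
  exact (contDiff_postcomp (n := n) _ Complex.contDiff_exp).comp
    ((toC.contDiff.const_smul _).sub contDiff_const)

/-- The complex normal mode `w(Y) e^{i(kX - ωt)}` along the motion `(X, Y)`. -/
noncomputable def modeAlong (w : C(ℝ, ℂ)) (k : ℝ) (ω : ℂ) (X Y : C(Icc t₀ t₁, ℝ)) :
    C(Icc t₀ t₁, ℂ) :=
  w.comp Y * wave k ω X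

lemma contDiff_modeAlong {n : ℕ} {w : C(ℝ, ℂ)} (hw : ContDiff ℝ n w) (k : ℝ) (ω : ℂ) :
    ContDiff ℝ n fun z : C(Icc t₀ t₁, ℝ) × C(Icc t₀ t₁, ℝ) => modeAlong w k ω z.1 z.2 :=
  ((contDiff_postcomp w hw).comp contDiff_snd).mul ((contDiff_wave k ω).comp contDiff_fst)

lemma isTrajectory_of_integral_eq (h : t₀ ≤ t₁) {U : C(ℝ, ℝ)} {uhat vhat : C(ℝ, ℂ)} {k : ℝ}
    {ω : ℂ} {ε : ℝ} {p : Plane} {X Y : C(Icc t₀ t₁, ℝ)}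
    (hX : X = p 0 • 1 + primitive h (U.comp Y)
      + ε • primitive h (reC (modeAlong uhat k ω X Y)))
    (hY : Y = p 1 • 1 + ε • primitive h (reC (modeAlong vhat k ω X Y))) :
    IsTrajectory (perturbedVelocity U uhat vhat k ω ε) t₀ t₁ p
      (fun t => !₂[X (projIcc t₀ t₁ h t), Y (projIcc t₀ t₁ h t)]) := by
  have eX : ∀ s, X s = p 0 + primitive h (U.comp Y) s
      + ε * primitive h (reC (modeAlong uhat k ω X Y)) s := fun s => by
    conv_lhs => rw [hX]
    simp
  have eY : ∀ s, Y s = p 1 + ε * primitive h (reC (modeAlong vhat k ω X Y)) s := fun s => by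
    conv_lhs => rw [hY]
    simp
  refine ⟨?_, fun t ht => ?_⟩
  · ext i
    fin_cases i
    · simp [eX, primitive_apply_left]
    · simp [eY, primitive_apply_left]
  · have dX := ((hasDerivWithinAt_primitive h (U.comp Y) ht).const_add (p 0)).add
      ((hasDerivWithinAt_primitive h (reC (modeAlong uhat k ω X Y)) ht).const_mul ε)
    have dY := ((hasDerivWithinAt_primitive h (reC (modeAlong vhat k ω X Y)) ht).const_mul
      ε).const_add (p 1)
    replace dX := dX.congr_of_mem (fun s _ => eX (projIcc t₀ t₁ h s)) ht
    replace dY := dY.congr_of_mem (fun s _ => eY (projIcc t₀ t₁ h s)) ht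
    refine (hasDerivWithinAt_plane dX dY).congr_deriv ?_
    ext i
    fin_cases i <;>
      simp [perturbedVelocity, baseVelocity, modeVelocity, modeAlong, wave_apply, projIcc_of_mem h ht]

/-- The integral equations have solutions that depend `C²` on the strength of the perturbation
and on the initial position: in the unknowns `W = X - ∫ U(Y)` and `Y` they read
`(W, Y) = p + ε Φ(W, Y)`. -/
lemma exists_contDiffAt_motion (h : t₀ ≤ t₁) {U : C(ℝ, ℝ)} {uhat vhat : C(ℝ, ℂ)} (k : ℝ) (ω : ℂ)
    (hU : ContDiff ℝ 2 U) (hu : ContDiff ℝ 2 uhat) (hv : ContDiff ℝ 2 vhat) (x₀ : Plane) :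
    ∃ X Y : ℝ × Plane → C(Icc t₀ t₁, ℝ),
      ContDiffAt ℝ 2 X (0, x₀) ∧ ContDiffAt ℝ 2 Y (0, x₀) ∧
      ∀ᶠ q in 𝓝 ((0 : ℝ), x₀),
        X q = q.2 0 • 1 + primitive h (U.comp (Y q))
          + q.1 • primitive h (reC (modeAlong uhat k ω (X q) (Y q))) ∧
        Y q = q.2 1 • 1 + q.1 • primitive h (reC (modeAlong vhat k ω (X q) (Y q))) := by
  have cU : ContDiff ℝ 2 fun Y : C(Icc t₀ t₁, ℝ) => U.comp Y := contDiff_postcomp (n := 2) U hU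
  have cX : ContDiff ℝ 2 fun z : C(Icc t₀ t₁, ℝ) × C(Icc t₀ t₁, ℝ) =>
      z.1 + primitive h (U.comp z.2) :=
    contDiff_fst.add ((primitive h).contDiff.comp (cU.comp contDiff_snd))
  have cmode : ∀ w : C(ℝ, ℂ), ContDiff ℝ 2 w →
      ContDiff ℝ 2 fun z : C(Icc t₀ t₁, ℝ) × C(Icc t₀ t₁, ℝ) =>
        primitive h (reC (modeAlong w k ω (z.1 + primitive h (U.comp z.2)) z.2)) := fun w hw =>
    (primitive h).contDiff.comp (reC.contDiff.comp
      ((contDiff_modeAlong (n := 2) hw k ω).comp (cX.prodMk contDiff_snd)))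
  obtain ⟨S, hS, -, hfix⟩ := exists_contDiffAt_fixedPoint ((cmode _ hu).prodMk (cmode _ hv))
    (x₀ 0 • (1 : C(Icc t₀ t₁, ℝ)), x₀ 1 • (1 : C(Icc t₀ t₁, ℝ)))
  let ι : ℝ × Plane → ℝ × (C(Icc t₀ t₁, ℝ) × C(Icc t₀ t₁, ℝ)) :=
    fun q => (q.1, q.2 0 • 1, q.2 1 • 1)
  have hι : ContDiff ℝ 2 ι := by
    have h0 : ContDiff ℝ 2 fun q : ℝ × Plane => q.2 0 := by fun_prop
    have h1 : ContDiff ℝ 2 fun q : ℝ × Plane => q.2 1 := by fun_prop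
    exact contDiff_fst.prodMk ((h0.smul contDiff_const).prodMk (h1.smul contDiff_const))
  have hSι : ContDiffAt ℝ 2 (fun q => S (ι q)) (0, x₀) :=
    ContDiffAt.comp (0, x₀) (g := S) hS hι.contDiffAt
  refine ⟨fun q => (S (ι q)).1 + primitive h (U.comp (S (ι q)).2), fun q => (S (ι q)).2,
    cX.contDiffAt.comp _ hSι, contDiff_snd.contDiffAt.comp _ hSι, ?_⟩
  filter_upwards [(hι.continuous.tendsto (0, x₀)).eventually hfix] with q hq
  constructor
  · conv_lhs => rw [show (S (ι q)).1 = _ from congrArg Prod.fst hq]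
    exact add_right_comm _ _ _
  · exact congrArg Prod.snd hq

end Integral

/-! ### The first-order response -/

section Taylor

variable {E : Type*} [NormedAddCommGroup E] [NormedSpace ℝ E]

/-- First-order Taylor expansion with a quadratic remainder. -/
lemma isBigO_sub_sub_deriv {f : ℝ → E} (hf : ContDiffAt ℝ 2 f 0) :
    (fun ε => f ε - (f 0 + ε • deriv f 0)) =O[𝓝 0] fun ε : ℝ => ε ^ 2 := by
  have hd : DifferentiableAt ℝ (deriv f) 0 := by
    have h1 : ContDiffAt ℝ 1 (fderiv ℝ f) 0 := hf.fderiv_right (by norm_num)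
    exact (h1.clm_apply contDiffAt_const).differentiableAt (by norm_num)
  obtain ⟨C, hC⟩ := hd.isBigO_sub.bound
  have hdiff : ∀ᶠ x in 𝓝 (0 : ℝ), DifferentiableAt ℝ f x :=
    (hf.eventually (by simp)).mono fun x hx => hx.differentiableAt (by norm_num)
  obtain ⟨δ, hδ, hball⟩ := Metric.eventually_nhds_iff.1 (hC.and hdiff)
  refine IsBigO.of_bound C ?_
  filter_upwards [Metric.ball_mem_nhds (0 : ℝ) hδ] with ε hε
  have hseg : ∀ x ∈ segment ℝ 0 ε, ‖x‖ ≤ ‖ε‖ := fun x hx => by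
    obtain ⟨τ, hτ, rfl⟩ := (segment_eq_image' ℝ (0 : ℝ) ε) ▸ hx
    simpa [abs_of_nonneg hτ.1] using mul_le_of_le_one_left (abs_nonneg ε) hτ.2
  have hmem : ∀ x ∈ segment ℝ 0 ε, dist x 0 < δ := fun x hx => by
    rw [dist_zero_right]
    exact (hseg x hx).trans_lt (by simpa using hε)
  have hC0 : ∀ x ∈ segment ℝ 0 ε, ‖deriv f x - deriv f 0‖ ≤ C * ‖ε‖ := fun x hx => by
    have hx' := (hball (hmem x hx)).1
    rw [sub_zero] at hx'
    by_cases h0 : x = 0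
    · subst h0
      by_cases hε0 : ε = 0
      · simp [hε0]
      · have := (norm_nonneg _).trans ((hball (show dist ε 0 < δ from hε)).1)
        simpa using this
    · have hCnn : 0 ≤ C :=
        nonneg_of_mul_nonneg_left ((norm_nonneg _).trans hx') (norm_pos_iff.2 h0)
      exact hx'.trans (mul_le_mul_of_nonneg_left (hseg x hx) hCnn)
  have := (convex_segment (0 : ℝ) ε).norm_image_sub_le_of_norm_hasDerivWithin_le
    (f := fun x => f x - x • deriv f 0) (f' := fun x => deriv f x - deriv f 0)
    (fun x hx => by
      have h1 := (hball (hmem x hx)).2.hasDerivAt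
      have h2 := (hasDerivAt_id x).smul_const (deriv f 0)
      rw [one_smul] at h2
      exact (h1.sub h2).hasDerivWithinAt) hC0
    (left_mem_segment ℝ _ _) (right_mem_segment ℝ _ _)
  simp only [zero_smul, sub_zero] at this
  calc ‖f ε - (f 0 + ε • deriv f 0)‖ = ‖f ε - ε • deriv f 0 - f 0‖ := by congr 1; abel
    _ ≤ C * ‖ε‖ * ‖ε‖ := this
    _ = C * ‖ε ^ 2‖ := by rw [norm_pow]; ring

lemma isBigO_plane {l : Filter ℝ} {f g : ℝ → ℝ} {φ : ℝ → ℝ} (hf : f =O[l] φ) (hg : g =O[l] φ) :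
    (fun ε => (!₂[f ε, g ε] : Plane)) =O[l] φ := by
  have h : (fun ε => ![f ε, g ε]) =O[l] φ := by
    rw [isBigO_pi]
    intro i
    fin_cases i
    · simpa using hf
    · simpa using hg
  exact ((EuclideanSpace.equiv (Fin 2) ℝ).symm.toContinuousLinearMap.isBigO_comp _ l).trans h

end Taylor

lemma fderiv_baseVelocity {U : ℝ → ℝ} (hU : ContDiff ℝ 1 U) (t : ℝ) (p a : Plane) :
    fderiv ℝ (baseVelocity U t) p a = !₂[deriv U (p 1) * a 1, 0] := by
  have hc : ContDiff ℝ 1 (baseVelocity U t) :=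
    contDiff_plane (hU.comp (by fun_prop : ContDiff ℝ 1 fun q : Plane => q 1)) contDiff_const
  have hline : HasDerivAt (fun τ : ℝ => p + τ • a) a 0 := by
    simpa using ((hasDerivAt_id (0 : ℝ)).smul_const a).const_add p
  have h1 : HasDerivAt (fun τ : ℝ => baseVelocity U t (p + τ • a))
      (fderiv ℝ (baseVelocity U t) p a) 0 :=
    HasFDerivAt.comp_hasDerivAt_of_eq (f := fun τ : ℝ => p + τ • a) 0
      (hc.differentiable (by norm_num) p).hasFDerivAt hline (by simp)
  have h3 : HasDerivAt (fun τ : ℝ => U (p 1 + τ * a 1)) (deriv U (p 1) * a 1) 0 :=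
    HasDerivAt.comp_of_eq (h := fun τ : ℝ => p 1 + τ * a 1) 0
      (hU.differentiable (by norm_num) (p 1)).hasDerivAt
      (by simpa using ((hasDerivAt_id (0 : ℝ)).mul_const (a 1)).const_add (p 1)) (by simp)
  have h2 := hasDerivWithinAt_plane h3.hasDerivWithinAt
    ((hasDerivAt_const (0 : ℝ) (0 : ℝ)).hasDerivWithinAt (s := univ))
  rw [hasDerivWithinAt_univ] at h2
  exact h1.unique h2

/-- Along the base trajectory, which keeps its cross-stream position, the linearized field has
the constant nilpotent matrix `[[0, U'(y₀)], [0, 0]]`. -/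
lemma response_field_eq {U : ℝ → ℝ} (hU : ContDiff ℝ 1 U) (uhat vhat : ℝ → ℂ) (k : ℝ) (ω : ℂ)
    {t₀ t : ℝ} (ht : t₀ ≤ t) (x₀ a : Plane) :
    fderiv ℝ (baseVelocity U t) (flowMap (baseVelocity U) t₀ t x₀) a
      + modeVelocity uhat vhat k ω t (flowMap (baseVelocity U) t₀ t x₀)
    = !₂[deriv U (x₀ 1) * a 1, 0]
      + modeVelocity uhat vhat k ω t !₂[x₀ 0 + U (x₀ 1) * (t - t₀), x₀ 1] := by
  have e : flowMap (baseVelocity U) t₀ t x₀ = !₂[x₀ 0 + U (x₀ 1) * (t - t₀), x₀ 1] := by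
    rw [flowMap_baseVelocity hU x₀ ht]
    ext i
    fin_cases i <;> simp [baseVelocity, mul_comm]
  rw [e, fderiv_baseVelocity hU]
  simp

lemma SolvesResponseIVP.eqOn {U : ℝ → ℝ} (hU : ContDiff ℝ 1 U) {uhat vhat : ℝ → ℂ} {k : ℝ} {ω : ℂ}
    {t₀ t₁ : ℝ} {x₀ : Plane} {A B : ℝ → Plane}
    (hA : SolvesResponseIVP U uhat vhat k ω t₀ t₁ x₀ A)
    (hB : SolvesResponseIVP U uhat vhat k ω t₀ t₁ x₀ B) : EqOn A B (Icc t₀ t₁) := by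
  refine eqOn_Icc_of_isIntegralCurveOn (fun R => ⟨‖deriv U (x₀ 1)‖₊, fun t ht => ?_⟩)
    hA.2 hB.2 (hA.1.trans hB.1.symm)
  refine (LipschitzWith.of_dist_le_mul fun a b => ?_).lipschitzOnWith
  rw [response_field_eq hU _ _ _ _ ht.1, response_field_eq hU _ _ _ _ ht.1, dist_add_right,
    EuclideanSpace.dist_eq]
  have h1 : dist (a 1) (b 1) ≤ dist a b := by
    simpa [dist_eq_norm] using PiLp.norm_apply_le (a - b) 1
  simpa [Real.sqrt_sq_eq_abs, abs_mul, dist_eq_norm, ← mul_sub] using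
    mul_le_mul_of_nonneg_left h1 (norm_nonneg (deriv U (x₀ 1)))

/-! ### The explicit response -/

lemma re_mul_wave (w ω : ℂ) (k x t : ℝ) :
    (w * Complex.exp (Complex.I * ((k : ℂ) * (x : ℂ) - ω * (t : ℂ)))).re =
      Real.exp (ω.im * t)
        * (w.re * Real.cos (k * x - ω.re * t) - w.im * Real.sin (k * x - ω.re * t)) := by
  rw [Complex.mul_re, Complex.exp_re, Complex.exp_im]
  have h1 : (Complex.I * ((k : ℂ) * (x : ℂ) - ω * (t : ℂ))).re = ω.im * t := by simp
  have h2 : (Complex.I * ((k : ℂ) * (x : ℂ) - ω * (t : ℂ))).im = k * x - ω.re * t := by simp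
  rw [h1, h2]
  ring

section Explicit

variable (k a b t₀ x c : ℝ)

/-- The shape of all the coefficient functions, as functions of the duration `T`. -/
lemma hasDerivAt_exp_mul_cos_sin (C₀ C₁ p q T : ℝ) :
    HasDerivAt (fun T => C₀ + C₁ * T
      + p * (Real.exp (b * (t₀ + T)) * Real.cos (k * x - a * (t₀ + T) + k * c * T))
      + q * (Real.exp (b * (t₀ + T)) * Real.sin (k * x - a * (t₀ + T) + k * c * T)))
      (C₁ + Real.exp (b * (t₀ + T)) *
        ((p * b - q * (a - k * c)) * Real.cos (k * x - a * (t₀ + T) + k * c * T)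
        + (p * (a - k * c) + q * b) * Real.sin (k * x - a * (t₀ + T) + k * c * T))) T := by
  have hs : HasDerivAt (fun T => t₀ + T) 1 T := (hasDerivAt_id T).const_add t₀
  have hθ : HasDerivAt (fun T => k * x - a * (t₀ + T) + k * c * T) (0 - a * 1 + k * c * 1) T :=
    ((hasDerivAt_const T _).sub (hs.const_mul a)).add ((hasDerivAt_id T).const_mul (k * c))
  have hE := (hs.const_mul b).exp
  have := ((((hasDerivAt_id T).const_mul C₁).const_add C₀).add
    ((hE.mul hθ.cos).const_mul p)).add ((hE.mul hθ.sin).const_mul q)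
  refine this.congr_deriv ?_
  ring

lemma hasDerivAt_f₅ (T : ℝ) : HasDerivAt (fun T => f₅ k a b t₀ T x c)
    (g k a b c * (Real.exp (b * (t₀ + T)) * Real.cos (k * x - a * (t₀ + T) + k * c * T))) T := by
  convert hasDerivAt_exp_mul_cos_sin k a b t₀ x c (f₅ k a b t₀ 0 x c
    - b * (Real.exp (b * t₀) * Real.cos (k * x - a * t₀))
    + (a - k * c) * (Real.exp (b * t₀) * Real.sin (k * x - a * t₀))) 0 b (-(a - k * c)) T using 1
  · funext T
    simp only [f₅, add_zero, mul_zero]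
    ring
  · simp only [g]
    ring

lemma hasDerivAt_f₆ (T : ℝ) : HasDerivAt (fun T => f₆ k a b t₀ T x c)
    (-g k a b c * (Real.exp (b * (t₀ + T)) * Real.sin (k * x - a * (t₀ + T) + k * c * T))) T := by
  convert hasDerivAt_exp_mul_cos_sin k a b t₀ x c (f₆ k a b t₀ 0 x c
    + b * (Real.exp (b * t₀) * Real.sin (k * x - a * t₀))
    + (a - k * c) * (Real.exp (b * t₀) * Real.cos (k * x - a * t₀))) 0 (-(a - k * c)) (-b) T using 1
  · funext T
    simp only [f₆, add_zero, mul_zero]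
    ring
  · simp only [g]
    ring

/-- The second component of the response forces the first one through the base shear; in the closed
formula this is the relation `f₃' = g f₅`, and likewise `f₄' = g f₆`. -/
lemma hasDerivAt_f₃ (T : ℝ) : HasDerivAt (fun T => f₃ k a b t₀ T x c)
    (g k a b c * f₅ k a b t₀ T x c) T := by
  convert hasDerivAt_exp_mul_cos_sin k a b t₀ x c
    (Real.exp (b * t₀) * (-(b ^ 2 - (a - k * c) ^ 2) * Real.cos (k * x - a * t₀)
      + 2 * b * (a - k * c) * Real.sin (k * x - a * t₀)))
    (Real.exp (b * t₀) * g k a b c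
      * (-b * Real.cos (k * x - a * t₀) + (a - k * c) * Real.sin (k * x - a * t₀)))
    (b ^ 2 - (a - k * c) ^ 2) (-(2 * b * (a - k * c))) T using 1
  · funext T
    simp only [f₃, g]
    ring
  · simp only [g, f₅]
    ring

lemma hasDerivAt_f₄ (T : ℝ) : HasDerivAt (fun T => f₄ k a b t₀ T x c)
    (g k a b c * f₆ k a b t₀ T x c) T := by
  convert hasDerivAt_exp_mul_cos_sin k a b t₀ x c
    (Real.exp (b * t₀) * ((b ^ 2 - (a - k * c) ^ 2) * Real.sin (k * x - a * t₀)
      + 2 * b * (a - k * c) * Real.cos (k * x - a * t₀)))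
    (Real.exp (b * t₀) * g k a b c
      * (b * Real.sin (k * x - a * t₀) + (a - k * c) * Real.cos (k * x - a * t₀)))
    (-(2 * b * (a - k * c))) (-(b ^ 2 - (a - k * c) ^ 2)) T using 1
  · funext T
    simp only [f₄, g]
    ring
  · simp only [g, f₆]
    ring

end Explicit

/-- The closed formula with duration `t - t₀`, as a function of `t`, solves the response problem. -/
lemma solvesResponseIVP_explicitResponse {U : ℝ → ℝ} (hU : ContDiff ℝ 1 U) (uhat vhat : ℝ → ℂ)
    (k : ℝ) (ω : ℂ) (t₀ t₁ : ℝ) (x₀ : Plane) (hg : g k ω.re ω.im (U (x₀ 1)) ≠ 0) :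
    SolvesResponseIVP U uhat vhat k ω t₀ t₁ x₀
      (fun t => explicitResponse U uhat vhat k ω t₀ (t - t₀) x₀) := by
  refine ⟨?_, fun t ht => ?_⟩
  · ext i
    fin_cases i
    · simp only [explicitResponse, f₁, f₂, f₃, f₄, sub_self, mul_zero, add_zero]
      simp
    · simp only [explicitResponse, f₅, f₆, sub_self, mul_zero, add_zero]
      simp
  · beta_reduce
    rw [response_field_eq hU _ _ _ _ ht.1]
    have hT : HasDerivAt (fun t => t - t₀) 1 t := (hasDerivAt_id t).sub_const t₀
    have h₃ := (hasDerivAt_f₃ k ω.re ω.im t₀ (x₀ 0) (U (x₀ 1)) (t - t₀)).comp t hT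
    have h₄ := (hasDerivAt_f₄ k ω.re ω.im t₀ (x₀ 0) (U (x₀ 1)) (t - t₀)).comp t hT
    have h₅ := (hasDerivAt_f₅ k ω.re ω.im t₀ (x₀ 0) (U (x₀ 1)) (t - t₀)).comp t hT
    have h₆ := (hasDerivAt_f₆ k ω.re ω.im t₀ (x₀ 0) (U (x₀ 1)) (t - t₀)).comp t hT
    have hx := (((h₅.mul_const (uhat (x₀ 1)).re).add (h₆.mul_const (uhat (x₀ 1)).im)).div_const
      (g k ω.re ω.im (U (x₀ 1)))).add
      ((((h₃.mul_const (vhat (x₀ 1)).re).mul_const (deriv U (x₀ 1))).add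
        ((h₄.mul_const (vhat (x₀ 1)).im).mul_const (deriv U (x₀ 1)))).div_const
      (g k ω.re ω.im (U (x₀ 1)) ^ 2))
    have hy := ((h₅.mul_const (vhat (x₀ 1)).re).add (h₆.mul_const (vhat (x₀ 1)).im)).div_const
      (g k ω.re ω.im (U (x₀ 1)))
    refine (hasDerivWithinAt_plane hx.hasDerivWithinAt hy.hasDerivWithinAt).congr_deriv ?_
    have e1 : t₀ + (t - t₀) = t := by ring
    have e2 : k * x₀ 0 - ω.re * t + k * U (x₀ 1) * (t - t₀)
        = k * (x₀ 0 + U (x₀ 1) * (t - t₀)) - ω.re * t := by ring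
    ext i
    fin_cases i
    · simp only [modeVelocity, re_mul_wave, explicitResponse, e1, e2, Fin.zero_eta,
        PiLp.add_apply, Matrix.cons_val_zero, Matrix.cons_val_one]
      field_simp
      ring
    · simp only [modeVelocity, re_mul_wave, e1, e2, Fin.mk_one,
        PiLp.add_apply, Matrix.cons_val_zero, Matrix.cons_val_one]
      field_simp
      ring

/-! ### Differentiation along a one-parameter family of trajectories -/

section Chain

variable {t₀ t₁ : ℝ}

/-- The derivative `D` is described by its values, so that it can be the product `f'(Y) Y'` for a
real-valued `f` as well as `f'(Y) * toC Y'` for a complex-valued one. -/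
lemma hasDerivAt_postcomp {F : Type} [NormedAddCommGroup F] [NormedSpace ℝ F] {f f' : C(ℝ, F)}
    (hf : ∀ y, HasDerivAt f (f' y) y) {Y : ℝ → C(Icc t₀ t₁, ℝ)} {Y' : C(Icc t₀ t₁, ℝ)} {s : ℝ}
    (hY : HasDerivAt Y Y' s) {D : C(Icc t₀ t₁, F)} (hD : ∀ t, D t = Y' t • f' (Y s t)) :
    HasDerivAt (fun s => f.comp (Y s)) D s := by
  have hc : Continuous fun y => ContinuousLinearMap.toSpanSingleton ℝ (f' y) :=
    (ContinuousLinearMap.toSpanSingletonCLE (𝕜 := ℝ) (E := F)).continuous.comp f'.continuous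
  refine ((hasFDerivAt_postcomp f ⟨_, hc⟩ (fun y => (hf y).hasFDerivAt) (Y s)).comp_hasDerivAt
    s hY).congr_deriv ?_
  ext t
  simp [hD]

lemma hasDerivAt_wave (k : ℝ) (ω : ℂ) {X : ℝ → C(Icc t₀ t₁, ℝ)} {X' : C(Icc t₀ t₁, ℝ)} {s : ℝ}
    (hX : HasDerivAt X X' s) :
    HasDerivAt (fun s => wave k ω (X s)) ((Complex.I * k) • (wave k ω (X s) * toC X')) s := by
  simp_rw [wave_eq_exp_comp]
  have hc : Continuous fun z => Complex.exp z • (1 : ℂ →L[ℝ] ℂ) :=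
    Complex.continuous_exp.smul continuous_const
  have h1 := ((toC.hasFDerivAt.comp_hasDerivAt s hX).const_smul (Complex.I * k)).sub_const
    (⟨fun t => Complex.I * (ω * ((t : ℝ) : ℂ)), by fun_prop⟩ : C(Icc t₀ t₁, ℂ))
  refine ((hasFDerivAt_postcomp ⟨Complex.exp, Complex.continuous_exp⟩ ⟨_, hc⟩
    (fun z => (Complex.hasDerivAt_exp z).complexToReal_fderiv) _).comp_hasDerivAt
    s h1).congr_deriv ?_
  ext t
  simp
  ring

lemma hasDerivAt_modeAlong {w w' : C(ℝ, ℂ)} (hw : ∀ y, HasDerivAt w (w' y) y) (k : ℝ) (ω : ℂ)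
    {X Y : ℝ → C(Icc t₀ t₁, ℝ)} {X' Y' : C(Icc t₀ t₁, ℝ)} {s : ℝ}
    (hX : HasDerivAt X X' s) (hY : HasDerivAt Y Y' s) :
    HasDerivAt (fun s => modeAlong w k ω (X s) (Y s))
      (modeAlong w' k ω (X s) (Y s) * toC Y'
        + (Complex.I * k) • (modeAlong w k ω (X s) (Y s) * toC X')) s := by
  have h1 := hasDerivAt_postcomp (D := w'.comp (Y s) * toC Y') hw hY
    (fun t => by simp [mul_comm])
  refine (h1.mul (hasDerivAt_wave k ω hX)).congr_deriv ?_
  ext t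
  simp [modeAlong]
  ring

end Chain

section Partial

variable {E : Type*} [NormedAddCommGroup E] [NormedSpace ℝ E]

/-- The partial derivative of `H` in the second variable. -/
noncomputable def partialSnd (H : ℝ × ℝ → E) (q : ℝ × ℝ) : E := deriv (fun s => H (q.1, s)) q.2

lemma hasDerivAt_partialSnd {H : ℝ × ℝ → E} {q : ℝ × ℝ} (h : DifferentiableAt ℝ H q) :
    HasDerivAt (fun s => H (q.1, s)) (partialSnd H q) q.2 := by
  have h1 : DifferentiableAt ℝ (fun s => H (q.1, s)) q.2 :=
    DifferentiableAt.comp q.2 (g := H) h (by fun_prop)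
  exact h1.hasDerivAt

lemma eventually_differentiableAt {H : ℝ × ℝ → E} {p : ℝ × ℝ} (h : ContDiffAt ℝ 1 H p) :
    ∀ᶠ q in 𝓝 p, DifferentiableAt ℝ H q :=
  (h.eventually (by simp)).mono fun _ hq => hq.differentiableAt (by simp)

lemma contDiffAt_partialSnd {m n : WithTop ℕ∞} {H : ℝ × ℝ → E} {p : ℝ × ℝ}
    (h : ContDiffAt ℝ n H p) (hmn : m + 1 ≤ n) : ContDiffAt ℝ m (partialSnd H) p := by
  have h1 : ContDiffAt ℝ m (fderiv ℝ H) p := h.fderiv_right hmn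
  refine (h1.clm_apply (contDiffAt_const (c := ((0 : ℝ), (1 : ℝ))))).congr_of_eventuallyEq ?_
  filter_upwards [eventually_differentiableAt (h.of_le (le_add_self.trans hmn))] with q hq
  have hline : HasDerivAt (fun s : ℝ => (q.1, s)) ((0 : ℝ), (1 : ℝ)) q.2 :=
    (hasDerivAt_const _ _).prodMk (hasDerivAt_id _)
  exact (HasFDerivAt.comp_hasDerivAt q.2 (f := fun s : ℝ => (q.1, s)) hq.hasFDerivAt hline).deriv

lemma eventuallyEq_partialSnd {H G : ℝ × ℝ → E} {p : ℝ × ℝ} (h : H =ᶠ[𝓝 p] G) :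
    partialSnd H =ᶠ[𝓝 p] partialSnd G := by
  filter_upwards [eventually_eventually_nhds.2 h] with q hq
  have hc : Tendsto (fun s : ℝ => (q.1, s)) (𝓝 q.2) (𝓝 q) :=
    (Continuous.prodMk_right q.1).tendsto q.2
  exact EventuallyEq.deriv_eq (hc.eventually hq)

/-- The form shared by the two integral equations is inherited by the partial derivative. -/
lemma eventuallyEq_partialSnd_of_affine {F G : Type*} [NormedAddCommGroup F] [NormedSpace ℝ F]
    [NormedAddCommGroup G] [NormedSpace ℝ G] {H : ℝ × ℝ → E} {A : ℝ × ℝ → F} {B : ℝ × ℝ → G}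
    {σ : ℝ → ℝ} {e : E} {L : F →L[ℝ] E} {M : G →L[ℝ] E} {p : ℝ × ℝ}
    (hσ : ContDiffAt ℝ 1 σ p.2) (hA : ContDiffAt ℝ 1 A p) (hB : ContDiffAt ℝ 1 B p)
    (hH : H =ᶠ[𝓝 p] fun q => σ q.2 • e + L (A q) + q.1 • M (B q)) :
    partialSnd H =ᶠ[𝓝 p] fun q =>
      deriv σ q.2 • e + L (partialSnd A q) + q.1 • M (partialSnd B q) := by
  refine (eventuallyEq_partialSnd hH).trans ?_
  have hσ' : ∀ᶠ q in 𝓝 p, DifferentiableAt ℝ σ q.2 :=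
    (continuous_snd.tendsto p).eventually
      ((hσ.eventually (by simp)).mono fun _ hq => hq.differentiableAt (by simp))
  filter_upwards [hσ', eventually_differentiableAt hA, eventually_differentiableAt hB]
    with q h1 h2 h3
  exact (((h1.hasDerivAt.smul_const e).add
    (L.hasFDerivAt.comp_hasDerivAt q.2 (hasDerivAt_partialSnd h2))).add
    ((M.hasFDerivAt.comp_hasDerivAt q.2 (hasDerivAt_partialSnd h3)).const_smul q.1)).deriv

section Slice

variable {H : ℝ × ℝ → E} {s₀ : ℝ}

lemma isBigO_slice_one {F : Type*} [NormedAddCommGroup F] {H : ℝ × ℝ → F} (h : ContinuousAt H (0, s₀)) :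
    (fun ε => H (ε, s₀)) =O[𝓝 0] fun _ => (1 : ℝ) :=
  Filter.Tendsto.isBigO_one ℝ
    (ContinuousAt.comp (g := H) (f := fun ε : ℝ => (ε, s₀)) h (by fun_prop)).tendsto

lemma isBigO_slice_sub (h : DifferentiableAt ℝ H (0, s₀)) :
    (fun ε => H (ε, s₀) - H (0, s₀)) =O[𝓝 0] fun ε : ℝ => ε := by
  have : DifferentiableAt ℝ (fun ε => H (ε, s₀)) 0 :=
    DifferentiableAt.comp (0 : ℝ) (g := H) h (by fun_prop)
  simpa using this.isBigO_sub

lemma isBigO_smul_slice (h : ContinuousAt H (0, s₀)) :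
    (fun ε => ε • H (ε, s₀)) =O[𝓝 0] fun ε : ℝ => ε := by
  simpa using (isBigO_refl (fun ε : ℝ => ε) (𝓝 0)).smul (isBigO_slice_one h)

end Slice

end Partial

section Linear

variable {R : Type*} [NormedRing R] {f g : ℝ → R} {a b : R}

lemma isBigO_mul_sub_mul (hf : (fun ε => f ε - a) =O[𝓝 0] fun ε : ℝ => ε)
    (hg : (fun ε => g ε - b) =O[𝓝 0] fun ε : ℝ => ε) :
    (fun ε => f ε * g ε - a * b) =O[𝓝 0] fun ε : ℝ => ε := by
  have hid : (fun ε : ℝ => ε) =O[𝓝 0] fun _ => (1 : ℝ) := continuous_id.continuousAt.isBigO_one ℝ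
  have hg1 : g =O[𝓝 0] fun _ => (1 : ℝ) := by
    simpa using (hg.trans hid).add (isBigO_const_const b one_ne_zero _)
  have h1 := hf.mul hg1
  have h2 := (isBigO_const_const a (one_ne_zero (α := ℝ)) (𝓝 (0 : ℝ))).mul hg
  simp only [mul_one, one_mul] at h1 h2
  refine (h1.add h2).congr_left fun ε => ?_
  noncomm_ring

end Linear

/-- The numerator of the curvature of the advected curve is `ε k² a + O(ε²)`: the contribution of
the tangential acceleration `α` cancels. -/
lemma isBigO_curvature {x₁ x₂ y₁ y₂ : ℝ → ℝ} {α a b m : ℝ}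
    (hx₁ : (fun ε => x₁ ε - 1) =O[𝓝 0] fun ε : ℝ => ε)
    (hx₂ : (fun ε => x₂ ε - α) =O[𝓝 0] fun ε : ℝ => ε)
    (hy₁ : (fun ε => y₁ ε - ε * b) =O[𝓝 0] fun ε : ℝ => ε ^ 2)
    (hy₂ : (fun ε => y₂ ε - ε * (α * b - m * a)) =O[𝓝 0] fun ε : ℝ => ε ^ 2) :
    (fun ε => (x₂ ε * y₁ ε - y₂ ε * x₁ ε) / Real.sqrt (x₁ ε ^ 2 + y₁ ε ^ 2) ^ 3 - m * a * ε)
      =O[𝓝 0] fun ε : ℝ => ε ^ 2 := by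
  have hid : (fun ε : ℝ => ε) =O[𝓝 0] fun _ => (1 : ℝ) := continuous_id.continuousAt.isBigO_one ℝ
  have hsq : (fun ε : ℝ => ε ^ 2) =O[𝓝 0] fun ε : ℝ => ε := by
    simpa [sq] using hid.mul (isBigO_refl (fun ε : ℝ => ε) (𝓝 0))
  have hlin : ∀ c : ℝ, (fun ε : ℝ => ε * c) =O[𝓝 0] fun ε : ℝ => ε := fun c => by
    simpa [mul_comm] using (isBigO_refl (fun ε : ℝ => ε) (𝓝 0)).const_mul_left c
  have hy₁' : y₁ =O[𝓝 0] fun ε : ℝ => ε := by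
    simpa using (hy₁.trans hsq).add (hlin b)
  have hx₁' : x₁ =O[𝓝 0] fun _ => (1 : ℝ) := by
    simpa using (hx₁.trans hid).add (isBigO_const_const (1 : ℝ) one_ne_zero _)
  have hnum : (fun ε => x₂ ε * y₁ ε - y₂ ε * x₁ ε - m * a * ε) =O[𝓝 0] fun ε : ℝ => ε ^ 2 := by
    have e1 : (fun ε => (x₂ ε - α) * y₁ ε) =O[𝓝 0] fun ε : ℝ => ε ^ 2 := by
      simpa [sq] using hx₂.mul hy₁'
    have e2 : (fun ε => (y₂ ε - ε * (α * b - m * a)) * x₁ ε) =O[𝓝 0] fun ε : ℝ => ε ^ 2 := by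
      simpa using hy₂.mul hx₁'
    have e3 : (fun ε => ε * (α * b - m * a) * (x₁ ε - 1)) =O[𝓝 0] fun ε : ℝ => ε ^ 2 := by
      simpa [sq] using (hlin _).mul hx₁
    refine (((e1.add (hy₁.const_mul_left α)).sub e2).sub e3).congr_left fun ε => ?_
    ring
  have hnum' : (fun ε => x₂ ε * y₁ ε - y₂ ε * x₁ ε) =O[𝓝 0] fun ε : ℝ => ε := by
    have := (hnum.trans hsq).add (hlin (m * a))
    refine this.congr_left fun ε => ?_
    ring
  have hden : (fun ε => (Real.sqrt (x₁ ε ^ 2 + y₁ ε ^ 2) ^ 3)⁻¹ - 1) =O[𝓝 0] fun ε : ℝ => ε := by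
    let φ : ℝ × ℝ → ℝ := fun z => (Real.sqrt (z.1 ^ 2 + z.2 ^ 2) ^ 3)⁻¹
    have hφ : DifferentiableAt ℝ φ (1, 0) := by
      refine DifferentiableAt.inv (DifferentiableAt.pow (DifferentiableAt.sqrt ?_ ?_) 3) ?_
      · fun_prop
      · norm_num
      · norm_num
    have hO : (fun ε => (x₁ ε, y₁ ε) - ((1 : ℝ), (0 : ℝ))) =O[𝓝 0] fun ε : ℝ => ε := by
      simpa using hx₁.prod_left hy₁'
    have ht : Tendsto (fun ε => (x₁ ε, y₁ ε)) (𝓝 0) (𝓝 ((1 : ℝ), (0 : ℝ))) := by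
      rw [tendsto_iff_norm_sub_tendsto_zero]
      exact (hO.trans_tendsto tendsto_id).norm.trans (by simp)
    refine ((hφ.isBigO_sub.comp_tendsto ht).trans hO).congr_left fun ε => ?_
    simp [φ]
  have h1 : (fun ε => (x₂ ε * y₁ ε - y₂ ε * x₁ ε)
      * ((Real.sqrt (x₁ ε ^ 2 + y₁ ε ^ 2) ^ 3)⁻¹ - 1)) =O[𝓝 0] fun ε : ℝ => ε ^ 2 := by
    simpa [sq] using hnum'.mul hden
  refine (h1.add hnum).congr_left fun ε => ?_
  rw [div_eq_mul_inv]
  ring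

/-! ### Expansion of the derivatives along a material line -/

section Family

variable {t₀ t₁ : ℝ}

lemma isBigO_toC {f : ℝ → C(Icc t₀ t₁, ℝ)} {a : C(Icc t₀ t₁, ℝ)}
    (hf : (fun ε => f ε - a) =O[𝓝 0] fun ε : ℝ => ε) :
    (fun ε => toC (f ε) - toC a) =O[𝓝 0] fun ε : ℝ => ε := by
  simp_rw [← map_sub]
  exact (toC.isBigO_comp _ _).trans hf

/-- First-order expansions of the derivatives, with respect to the parameter `s` of the initial
position `(ρ s, σ s)`, of a family of trajectories. With `V₀` the lateral mode along the base
trajectory, `∂V = ikV₀ + O(ε)` and `∂²V = (ikα - k²) V₀ + O(ε)`, because `∂Y` and `∂²Y` are `O(ε)`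
when the initial curve is stream-wise and straight at `s₀`;
the integral equation for `Y` turns these into expansions of `∂Y` and `∂²Y` up to `O(ε²)`, for
which mere continuity of `v̂''` suffices. -/
lemma isBigO_family (h : t₀ ≤ t₁) {U U' : C(ℝ, ℝ)} {uhat vhat vhat' : C(ℝ, ℂ)} (k : ℝ) (ω : ℂ)
    (hU : ContDiff ℝ 2 U) (hu : ContDiff ℝ 2 uhat) (hv : ContDiff ℝ 2 vhat)
    (hUU' : ∀ y, HasDerivAt U (U' y) y) (hU' : ContDiff ℝ 1 U')
    (hvv' : ∀ y, HasDerivAt vhat (vhat' y) y) (hv' : ContDiff ℝ 1 vhat')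
    {ρ σ : ℝ → ℝ} {s₀ α : ℝ} (hρ : ContDiffAt ℝ 2 ρ s₀) (hσ : ContDiffAt ℝ 2 σ s₀)
    (hρ₁ : deriv ρ s₀ = 1) (hρ₂ : deriv (deriv ρ) s₀ = α)
    (hσ₁ : deriv σ s₀ = 0) (hσ₂ : deriv (deriv σ) s₀ = 0)
    {X Y : ℝ × ℝ → C(Icc t₀ t₁, ℝ)} (hX : ContDiffAt ℝ 2 X (0, s₀))
    (hY : ContDiffAt ℝ 2 Y (0, s₀))
    (heq : ∀ᶠ q in 𝓝 ((0 : ℝ), s₀),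
      X q = ρ q.2 • 1 + primitive h (U.comp (Y q))
        + q.1 • primitive h (reC (modeAlong uhat k ω (X q) (Y q))) ∧
      Y q = σ q.2 • 1 + q.1 • primitive h (reC (modeAlong vhat k ω (X q) (Y q))))
    {V₀ L : C(Icc t₀ t₁, ℂ)} (hV₀ : V₀ = modeAlong vhat k ω (X (0, s₀)) (Y (0, s₀)))
    (hL : L = (Complex.I * k) • V₀) :
    ((fun ε => partialSnd X (ε, s₀) - 1) =O[𝓝 0] fun ε : ℝ => ε) ∧
    ((fun ε => partialSnd (partialSnd X) (ε, s₀) - α • 1) =O[𝓝 0] fun ε : ℝ => ε) ∧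
    ((fun ε => partialSnd Y (ε, s₀) - ε • primitive h (reC L)) =O[𝓝 0] fun ε : ℝ => ε ^ 2) ∧
    ((fun ε => partialSnd (partialSnd Y) (ε, s₀)
      - ε • primitive h (reC (α • L - k ^ 2 • V₀))) =O[𝓝 0] fun ε : ℝ => ε ^ 2) := by
  have h12 : (1 : WithTop ℕ∞) ≤ 2 := by norm_num
  have h11 : (1 : WithTop ℕ∞) + 1 ≤ 2 := by norm_num
  have h01 : (0 : WithTop ℕ∞) + 1 ≤ 1 := by norm_num
  -- smoothness of the composite functions of `(ε, s)`
  have cmode : ∀ {n : ℕ} {w : C(ℝ, ℂ)}, (n : WithTop ℕ∞) ≤ 2 → ContDiff ℝ n w →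
      ContDiffAt ℝ n (fun q => modeAlong w k ω (X q) (Y q)) (0, s₀) := fun hn hw =>
    (contDiff_modeAlong hw k ω).contDiffAt.comp (f := fun q => (X q, Y q)) (0, s₀)
      ((hX.of_le hn).prodMk (hY.of_le hn))
  let V : ℝ × ℝ → C(Icc t₀ t₁, ℂ) := fun q => modeAlong vhat k ω (X q) (Y q)
  let W : ℝ × ℝ → C(Icc t₀ t₁, ℂ) := fun q => modeAlong uhat k ω (X q) (Y q)
  let M : ℝ × ℝ → C(Icc t₀ t₁, ℂ) := fun q => modeAlong vhat' k ω (X q) (Y q)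
  let N : ℝ × ℝ → C(Icc t₀ t₁, ℝ) := fun q => U.comp (Y q)
  let N' : ℝ × ℝ → C(Icc t₀ t₁, ℝ) := fun q => U'.comp (Y q)
  have cV : ContDiffAt ℝ 2 V (0, s₀) := cmode (n := 2) le_rfl hv
  have cW : ContDiffAt ℝ 2 W (0, s₀) := cmode (n := 2) le_rfl hu
  have cM : ContDiffAt ℝ 1 M (0, s₀) := cmode (n := 1) h12 hv'
  have cN : ContDiffAt ℝ 2 N (0, s₀) :=
    ContDiffAt.comp (0, s₀) (contDiff_postcomp (n := 2) U hU).contDiffAt hY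
  have cN' : ContDiffAt ℝ 1 N' (0, s₀) :=
    ContDiffAt.comp (0, s₀) (contDiff_postcomp (n := 1) U' hU').contDiffAt (hY.of_le h12)
  have cX₁ := contDiffAt_partialSnd hX h11
  have cY₁ := contDiffAt_partialSnd hY h11
  have cV₁ := contDiffAt_partialSnd cV h11
  have cW₁ := contDiffAt_partialSnd cW h11
  have cN₁ := contDiffAt_partialSnd cN h11
  have cρ₁ : ContDiffAt ℝ 1 (deriv ρ) s₀ :=
    (hρ.fderiv_right h11).clm_apply contDiffAt_const
  have cσ₁ : ContDiffAt ℝ 1 (deriv σ) s₀ :=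
    (hσ.fderiv_right h11).clm_apply contDiffAt_const
  have dX := eventually_differentiableAt (hX.of_le h12)
  have dY := eventually_differentiableAt (hY.of_le h12)
  -- the differentiated integral equations
  let J : C(Icc t₀ t₁, ℂ) →L[ℝ] C(Icc t₀ t₁, ℝ) := (primitive h).comp reC
  have eX : X =ᶠ[𝓝 (0, s₀)] fun q => ρ q.2 • 1 + primitive h (N q) + q.1 • J (W q) :=
    heq.mono fun q hq => hq.1
  -- a vanishing middle term gives both equations the same form
  have eY : Y =ᶠ[𝓝 (0, s₀)] fun q =>
      σ q.2 • 1 + (0 : ℝ →L[ℝ] C(Icc t₀ t₁, ℝ)) 0 + q.1 • J (V q) :=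
    heq.mono fun q hq => hq.2.trans (by beta_reduce; rw [map_zero, add_zero]; rfl)
  have eX₁ := eventuallyEq_partialSnd_of_affine (hρ.of_le h12) (cN.of_le h12) (cW.of_le h12) eX
  have eX₂ := eventuallyEq_partialSnd_of_affine cρ₁ cN₁ cW₁ eX₁
  have eY₁ := eventuallyEq_partialSnd_of_affine (A := fun _ => (0 : ℝ)) (hσ.of_le h12)
    contDiffAt_const (cV.of_le h12) eY
  have eY₂ := eventuallyEq_partialSnd_of_affine cσ₁
    (contDiffAt_partialSnd (H := fun _ => (0 : ℝ)) contDiffAt_const h11) cV₁ eY₁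
  have eN₁ : partialSnd N =ᶠ[𝓝 (0, s₀)] fun q => N' q * partialSnd Y q := by
    filter_upwards [dY] with q hq
    exact (hasDerivAt_postcomp hUU' (hasDerivAt_partialSnd hq)
      (fun t => by simp [N', mul_comm])).deriv
  have eN₂ : partialSnd (partialSnd N) =ᶠ[𝓝 (0, s₀)] fun q =>
      partialSnd N' q * partialSnd Y q + N' q * partialSnd (partialSnd Y) q := by
    refine (eventuallyEq_partialSnd eN₁).trans ?_
    filter_upwards [eventually_differentiableAt cN', eventually_differentiableAt cY₁] with q h1 h2
    exact ((hasDerivAt_partialSnd h1).mul (hasDerivAt_partialSnd h2)).deriv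
  have eV₁ : partialSnd V =ᶠ[𝓝 (0, s₀)] fun q => M q * toC (partialSnd Y q)
      + (Complex.I * k) • (V q * toC (partialSnd X q)) := by
    filter_upwards [dX, dY] with q h1 h2
    exact (hasDerivAt_modeAlong hvv' k ω (hasDerivAt_partialSnd h1)
      (hasDerivAt_partialSnd h2)).deriv
  have eV₂ : partialSnd (partialSnd V) =ᶠ[𝓝 (0, s₀)] fun q =>
      (partialSnd M q * toC (partialSnd Y q) + M q * toC (partialSnd (partialSnd Y) q))
      + (Complex.I * k) • (partialSnd V q * toC (partialSnd X q)
        + V q * toC (partialSnd (partialSnd X) q)) := by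
    refine (eventuallyEq_partialSnd eV₁).trans ?_
    have htoC : ∀ {H : ℝ × ℝ → C(Icc t₀ t₁, ℝ)} {q : ℝ × ℝ}, DifferentiableAt ℝ H q →
        HasDerivAt (fun s => toC (H (q.1, s))) (toC (partialSnd H q)) q.2 := fun hq =>
      toC.hasFDerivAt.comp_hasDerivAt _ (hasDerivAt_partialSnd hq)
    filter_upwards [eventually_differentiableAt cM, eventually_differentiableAt (cV.of_le h12),
      eventually_differentiableAt cX₁, eventually_differentiableAt cY₁] with q h1 h2 h3 h4
    exact (((hasDerivAt_partialSnd h1).mul (htoC h4)).add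
      (((hasDerivAt_partialSnd h2).mul (htoC h3)).const_smul (Complex.I * (k : ℂ)))).deriv
  -- restriction to `s = s₀`
  have slice : ∀ {P : ℝ × ℝ → Prop}, (∀ᶠ q in 𝓝 ((0 : ℝ), s₀), P q) →
      ∀ᶠ ε in 𝓝 (0 : ℝ), P (ε, s₀) := fun hP =>
    (Continuous.prodMk_left s₀).tendsto (0 : ℝ) |>.eventually hP
  have hJ : ∀ {f : ℝ → C(Icc t₀ t₁, ℂ)} {φ : ℝ → ℝ}, f =O[𝓝 0] φ →
      (fun ε => J (f ε)) =O[𝓝 0] φ := fun hf => (J.isBigO_comp _ _).trans hf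
  have hC : ∀ {f : ℝ → C(Icc t₀ t₁, ℝ)} {φ : ℝ → ℝ}, f =O[𝓝 0] φ →
      (fun ε => toC (f ε)) =O[𝓝 0] φ := fun hf => (toC.isBigO_comp _ _).trans hf
  have cont : ∀ {E : Type} [NormedAddCommGroup E] [NormedSpace ℝ E] {H : ℝ × ℝ → E},
      ContDiffAt ℝ 1 H (0, s₀) → ContinuousAt (partialSnd H) (0, s₀) := fun hH =>
    (contDiffAt_partialSnd hH h01).continuousAt
  have sJ : ∀ {B : ℝ × ℝ → C(Icc t₀ t₁, ℂ)}, ContinuousAt B (0, s₀) →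
      (fun ε => ε • J (B (ε, s₀))) =O[𝓝 0] fun ε : ℝ => ε := fun {B} hB =>
    isBigO_smul_slice (H := fun q => J (B q)) (J.continuous.continuousAt.comp hB)
  have bY₁ : (fun ε => partialSnd Y (ε, s₀)) =O[𝓝 0] fun ε : ℝ => ε := by
    refine (sJ cV₁.continuousAt).congr' ?_ EventuallyEq.rfl
    filter_upwards [slice eY₁] with ε hε
    simp [hε, hσ₁]
  have bY₂ : (fun ε => partialSnd (partialSnd Y) (ε, s₀)) =O[𝓝 0] fun ε : ℝ => ε := by
    refine (sJ (cont cV₁)).congr' ?_ EventuallyEq.rfl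
    filter_upwards [slice eY₂] with ε hε
    simp [hε, hσ₂]
  have bmul : ∀ {R : Type} [NormedRing R] [NormedSpace ℝ R] {H : ℝ × ℝ → R} {f : ℝ → R},
      ContinuousAt H (0, s₀) → f =O[𝓝 0] (fun ε : ℝ => ε) →
      (fun ε => H (ε, s₀) * f ε) =O[𝓝 0] fun ε : ℝ => ε := fun hH hf => by
    simpa using (isBigO_slice_one hH).mul hf
  have oX₁ : (fun ε => partialSnd X (ε, s₀) - 1) =O[𝓝 0] fun ε : ℝ => ε := by
    have h1 := ((primitive h).isBigO_comp _ _).trans (bmul cN'.continuousAt bY₁)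
    refine (h1.add (sJ cW₁.continuousAt)).congr' ?_ EventuallyEq.rfl
    filter_upwards [slice eX₁, slice eN₁] with ε hε hN
    simp [hε, hN, hρ₁, add_assoc]
  have oX₂ : (fun ε => partialSnd (partialSnd X) (ε, s₀) - α • 1) =O[𝓝 0] fun ε : ℝ => ε := by
    have h1 := ((primitive h).isBigO_comp _ _).trans
      ((bmul (cont cN') bY₁).add (bmul cN'.continuousAt bY₂))
    refine (h1.add (sJ (cont cW₁))).congr' ?_ EventuallyEq.rfl
    filter_upwards [slice eX₂, slice eN₂] with ε hε hN
    simp [hε, hN, hρ₂, add_assoc]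
  -- expansions up to `O(ε)`; `M` is only `C¹`, so of `partialSnd M` only boundedness is used
  have oV : (fun ε => V (ε, s₀) - V₀) =O[𝓝 0] fun ε : ℝ => ε := by
    rw [hV₀]
    exact isBigO_slice_sub (cV.differentiableAt (by norm_num))
  have oV₁ : (fun ε => partialSnd V (ε, s₀) - L) =O[𝓝 0] fun ε : ℝ => ε := by
    have h1 := bmul cM.continuousAt (hC bY₁)
    have h2 := (isBigO_mul_sub_mul oV (isBigO_toC oX₁)).const_smul_left (Complex.I * (k : ℂ))
    refine (h1.add h2).congr' ?_ EventuallyEq.rfl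
    filter_upwards [slice eV₁] with ε hε
    rw [hε, hL]
    ext t
    simp
    ring
  have oV₂ : (fun ε => partialSnd (partialSnd V) (ε, s₀) - (α • L - k ^ 2 • V₀))
      =O[𝓝 0] fun ε : ℝ => ε := by
    have h1 := (bmul (cont cM) (hC bY₁)).add (bmul cM.continuousAt (hC bY₂))
    have h2 := ((isBigO_mul_sub_mul oV₁ (isBigO_toC oX₁)).add
      (isBigO_mul_sub_mul oV (isBigO_toC oX₂))).const_smul_left (Complex.I * (k : ℂ))
    refine (h1.add h2).congr' ?_ EventuallyEq.rfl
    filter_upwards [slice eV₂] with ε hε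
    rw [hε, hL]
    ext t
    simp
    linear_combination (-(k : ℂ) ^ 2 * V₀ t) * Complex.I_sq
  have final : ∀ {f : ℝ → C(Icc t₀ t₁, ℂ)}, f =O[𝓝 0] (fun ε : ℝ => ε) →
      (fun ε => ε • J (f ε)) =O[𝓝 0] fun ε : ℝ => ε ^ 2 := fun hf => by
    simpa [sq] using (isBigO_refl (fun ε : ℝ => ε) (𝓝 0)).smul (hJ hf)
  refine ⟨oX₁, oX₂, (final oV₁).congr' ?_ EventuallyEq.rfl, (final oV₂).congr' ?_ EventuallyEq.rfl⟩
  · filter_upwards [slice eY₁] with ε hε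
    rw [hε, map_sub, smul_sub]
    simp [hσ₁, J]
  · filter_upwards [slice eY₂] with ε hε
    rw [hε, map_sub, smul_sub]
    simp [hσ₂, J]

end Family

/-! ### The response as a derivative in the strength of the perturbation -/

section Response

variable {t₀ t₁ : ℝ}

/-- Differentiating the integral equations at `ε = 0` gives the response problem. -/
lemma solvesResponseIVP_deriv (h : t₀ ≤ t₁) {U U' : C(ℝ, ℝ)} {uhat vhat uhat' vhat' : C(ℝ, ℂ)}
    (k : ℝ) (ω : ℂ) (hUU' : ∀ y, HasDerivAt U (U' y) y)
    (huu' : ∀ y, HasDerivAt uhat (uhat' y) y) (hvv' : ∀ y, HasDerivAt vhat (vhat' y) y)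
    {p : Plane} {X Y : ℝ → C(Icc t₀ t₁, ℝ)} (hX : DifferentiableAt ℝ X 0)
    (hY : DifferentiableAt ℝ Y 0)
    (heq : ∀ᶠ ε in 𝓝 (0 : ℝ),
      X ε = p 0 • 1 + primitive h (U.comp (Y ε))
        + ε • primitive h (reC (modeAlong uhat k ω (X ε) (Y ε))) ∧
      Y ε = p 1 • 1 + ε • primitive h (reC (modeAlong vhat k ω (X ε) (Y ε)))) :
    SolvesResponseIVP U uhat vhat k ω t₀ t₁ p
      (fun t => !₂[deriv X 0 (projIcc t₀ t₁ h t), deriv Y 0 (projIcc t₀ t₁ h t)]) ∧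
    deriv Y 0 = primitive h (reC (modeAlong vhat k ω (X 0) (Y 0))) := by
  have hU1 : ContDiff ℝ 1 U := by
    rw [contDiff_one_iff_deriv]
    exact ⟨fun y => (hUU' y).differentiableAt, by
      simpa only [funext fun y => (hUU' y).deriv] using U'.continuous⟩
  have hmode : ∀ {w w' : C(ℝ, ℂ)}, (∀ y, HasDerivAt w (w' y) y) →
      HasDerivAt (fun ε : ℝ => ε • primitive h (reC (modeAlong w k ω (X ε) (Y ε))))
        (primitive h (reC (modeAlong w k ω (X 0) (Y 0)))) 0 := fun hw => by
    have h1 := (primitive h).hasFDerivAt.comp_hasDerivAt (0 : ℝ)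
      (reC.hasFDerivAt.comp_hasDerivAt (0 : ℝ)
        (hasDerivAt_modeAlong hw k ω hX.hasDerivAt hY.hasDerivAt))
    exact ((hasDerivAt_id (0 : ℝ)).smul h1).congr_deriv (by simp)
  have eY : deriv Y 0 = primitive h (reC (modeAlong vhat k ω (X 0) (Y 0))) :=
    (((hmode hvv').const_add (p 1 • 1)).congr_of_eventuallyEq
      (heq.mono fun ε hε => hε.2)).deriv
  have hUY := hasDerivAt_postcomp (D := U'.comp (Y 0) * deriv Y 0) hUU' hY.hasDerivAt
    (fun t => by simp [mul_comm])
  have eX : deriv X 0 = primitive h (U'.comp (Y 0) * deriv Y 0)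
      + primitive h (reC (modeAlong uhat k ω (X 0) (Y 0))) :=
    (((((primitive h).hasFDerivAt.comp_hasDerivAt (0 : ℝ) hUY).const_add (p 0 • 1)).add
      (hmode huu')).congr_of_eventuallyEq (heq.mono fun ε hε => hε.1)).deriv
  have Y0 : ∀ t, Y 0 t = p 1 := fun t => by rw [heq.self_of_nhds.2]; simp
  have X0 : ∀ t, X 0 t = p 0 + U (p 1) * (t - t₀) := fun t => by
    rw [heq.self_of_nhds.1]
    simp [primitive_apply, Y0, mul_comm]
  refine ⟨⟨?_, fun t ht => ?_⟩, eY⟩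
  · ext i
    fin_cases i
    · simp [eX, primitive_apply_left]
    · simp [eY, primitive_apply_left]
  · beta_reduce
    rw [response_field_eq hU1 _ _ _ _ ht.1]
    have dX := (hasDerivWithinAt_primitive h (U'.comp (Y 0) * deriv Y 0) ht).add
      (hasDerivWithinAt_primitive h (reC (modeAlong uhat k ω (X 0) (Y 0))) ht)
    have dY := hasDerivWithinAt_primitive h (reC (modeAlong vhat k ω (X 0) (Y 0))) ht
    replace dX := dX.congr_of_mem
      (fun s _ => congrArg (fun f => f (projIcc t₀ t₁ h s)) eX) ht
    replace dY := dY.congr_of_mem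
      (fun s _ => congrArg (fun f => f (projIcc t₀ t₁ h s)) eY) ht
    refine (hasDerivWithinAt_plane dX dY).congr_deriv ?_
    ext i
    fin_cases i <;>
      simp [modeVelocity, modeAlong, wave_apply, projIcc_of_mem h ht, X0, Y0, (hUU' _).deriv]

end Response

/-! ### Curvature -/

lemma deriv_apply {c : ℝ → Plane} {s : ℝ} (hc : DifferentiableAt ℝ c s) (i : Fin 2) :
    deriv c s i = deriv (fun s => c s i) s :=
  ((EuclideanSpace.proj i : Plane →L[ℝ] ℝ).hasFDerivAt.comp_hasDerivAt s
    hc.hasDerivAt).deriv.symm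

lemma deriv_deriv_apply {c : ℝ → Plane} {s : ℝ} (hc : ContDiffAt ℝ 2 c s) (i : Fin 2) :
    deriv (deriv c) s i = deriv (deriv fun s => c s i) s := by
  have h1 : ContDiffAt ℝ 1 (deriv c) s :=
    (hc.fderiv_right (m := 1) (by norm_num)).clm_apply contDiffAt_const
  rw [deriv_apply (h1.differentiableAt (by norm_num))]
  refine EventuallyEq.deriv_eq ?_
  filter_upwards [hc.eventually (by simp)] with s' hs'
  exact deriv_apply (hs'.differentiableAt (by norm_num)) i

lemma curvature_eq {c : ℝ → Plane} {s : ℝ} (hc : ContDiffAt ℝ 2 c s) :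
    curvature c s =
      (deriv (deriv fun s => c s 0) s * deriv (fun s => c s 1) s
        - deriv (deriv fun s => c s 1) s * deriv (fun s => c s 0) s)
      / Real.sqrt (deriv (fun s => c s 0) s ^ 2 + deriv (fun s => c s 1) s ^ 2) ^ 3 := by
  have hd := hc.differentiableAt (by norm_num)
  rw [← deriv_deriv_apply hc, ← deriv_deriv_apply hc, ← deriv_apply hd, ← deriv_apply hd]
  simp only [curvature, rot, PiLp.inner_apply, Fin.sum_univ_two]
  simp
  ring_nf

/-- A function of `s` that agrees near `s₀` with `H(ε, s) t` has the derivatives of the latter. -/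
lemma eventually_deriv_slice {K : Type} [TopologicalSpace K] [CompactSpace K]
    {H : ℝ × ℝ → C(K, ℝ)} {s₀ : ℝ} (hH : ContDiffAt ℝ 2 H (0, s₀)) (t : K) :
    ∀ᶠ ε in 𝓝 (0 : ℝ), ∀ f : ℝ → ℝ, (∀ᶠ s in 𝓝 s₀, f s = H (ε, s) t) →
      ContDiffAt ℝ 2 f s₀ ∧ deriv f s₀ = partialSnd H (ε, s₀) t ∧
      deriv (deriv f) s₀ = partialSnd (partialSnd H) (ε, s₀) t := by
  have hslice : Tendsto (fun ε : ℝ => (ε, s₀)) (𝓝 0) (𝓝 (0, s₀)) :=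
    (Continuous.prodMk_left s₀).tendsto (0 : ℝ)
  have hH₁ := contDiffAt_partialSnd hH (m := 1) (by norm_num)
  have heval : ∀ {G : ℝ × ℝ → C(K, ℝ)} {q : ℝ × ℝ}, DifferentiableAt ℝ G q →
      deriv (fun s => G (q.1, s) t) q.2 = partialSnd G q t := fun hG =>
    ((ContinuousMap.evalCLM ℝ t : C(K, ℝ) →L[ℝ] ℝ).hasFDerivAt.comp_hasDerivAt _ (hasDerivAt_partialSnd hG)).deriv
  have hd := hslice.eventually
    (eventually_eventually_nhds.2 (eventually_differentiableAt (hH.of_le (by norm_num))))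
  filter_upwards [hslice.eventually (hH.eventually (by simp)), hd,
    hslice.eventually (eventually_differentiableAt hH₁)] with ε h1 h2 h3 f hf
  have hε : Tendsto (fun s : ℝ => (ε, s)) (𝓝 s₀) (𝓝 (ε, s₀)) :=
    (Continuous.prodMk_right ε).tendsto s₀
  refine ⟨?_, ?_, ?_⟩
  · have h4 : ContDiffAt ℝ 2 (fun s => H (ε, s)) s₀ :=
      ContDiffAt.comp s₀ (g := H) h1 (by fun_prop)
    exact ((ContinuousMap.evalCLM ℝ t : C(K, ℝ) →L[ℝ] ℝ).contDiff.contDiffAt.comp s₀ h4).congr_of_eventuallyEq hf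
  · rw [EventuallyEq.deriv_eq hf]
    exact heval h2.self_of_nhds
  · rw [← heval h3]
    refine EventuallyEq.deriv_eq ?_
    filter_upwards [EventuallyEq.deriv hf, hε.eventually h2] with s h4 h5
    rw [h4]
    exact heval h5

end ShearFlow

theorem theorem1 (U : ℝ → ℝ) (uhat vhat : ℝ → ℂ) (k : ℝ) (ω : ℂ) (t₀ T : ℝ) (x₀ : Plane)
    (hU : ContDiff ℝ 2 U) (hu : ContDiff ℝ 2 uhat) (hv : ContDiff ℝ 2 vhat) (hT : 0 ≤ T) :
    -- the flow map of the perturbed flow is well defined near `x₀` for all small `ε > 0`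
    (∀ᶠ q : ℝ × Plane in 𝓝[>] (0 : ℝ) ×ˢ 𝓝 x₀,
      IsTrajectory (perturbedVelocity U uhat vhat k ω q.1) t₀ (t₀ + T) q.2
        (fun t => flowMap (perturbedVelocity U uhat vhat k ω q.1) t₀ t q.2) ∧
      ∀ γ : ℝ → Plane,
        IsTrajectory (perturbedVelocity U uhat vhat k ω q.1) t₀ (t₀ + T) q.2 γ →
        EqOn γ (fun t => flowMap (perturbedVelocity U uhat vhat k ω q.1) t₀ t q.2)
          (Icc t₀ (t₀ + T))) ∧
    -- the base flow map
    (∀ t ∈ Icc t₀ (t₀ + T),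
      flowMap (baseVelocity U) t₀ t x₀ = x₀ + (t - t₀) • baseVelocity U t₀ x₀) ∧
    -- the leading-order expansion of the perturbed flow map
    (∃ A : ℝ → Plane,
      SolvesResponseIVP U uhat vhat k ω t₀ (t₀ + T) x₀ A ∧
      (∀ B : ℝ → Plane, SolvesResponseIVP U uhat vhat k ω t₀ (t₀ + T) x₀ B →
        EqOn B A (Icc t₀ (t₀ + T))) ∧
      ((fun ε : ℝ => flowMap (perturbedVelocity U uhat vhat k ω ε) t₀ (t₀ + T) x₀
          - (flowMap (baseVelocity U) t₀ (t₀ + T) x₀ + ε • A (t₀ + T)))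
        =O[𝓝[>] 0] fun ε : ℝ => ε ^ 2) ∧
      (g k ω.re ω.im (U (x₀ 1)) ≠ 0 →
        A (t₀ + T) = explicitResponse U uhat vhat k ω t₀ T x₀)) ∧
    -- the curvature change of an initially straight, stream-wise material line through `x₀`
    (∀ (r : ℝ → Plane) (s₀ : ℝ), ContDiffAt ℝ 2 r s₀ → r s₀ = x₀ → deriv r s₀ = !₂[1, 0] →
      curvature r s₀ = 0 →
      (∀ᶠ ε : ℝ in 𝓝[>] 0,
        ContDiffAt ℝ 2
          (flowMap (perturbedVelocity U uhat vhat k ω ε) t₀ (t₀ + T) ∘ r) s₀ ∧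
        deriv (flowMap (perturbedVelocity U uhat vhat k ω ε) t₀ (t₀ + T) ∘ r) s₀ ≠ 0) ∧
      (g k ω.re ω.im (U (x₀ 1)) ≠ 0 →
        (fun ε : ℝ =>
          curvatureChange (flowMap (perturbedVelocity U uhat vhat k ω ε) t₀ (t₀ + T)) r s₀
            - curvatureRate k ω t₀ T (x₀ 0) (U (x₀ 1)) (vhat (x₀ 1)) * ε)
        =O[𝓝[>] 0] fun ε : ℝ => ε ^ 2)) := by
  have h01 : t₀ ≤ t₀ + T := le_add_of_nonneg_right hT
  have hU1 : ContDiff ℝ 1 U := hU.of_le (by norm_num)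
  have hsucc : ∀ {F : Type} [NormedAddCommGroup F] [NormedSpace ℝ F] {f : ℝ → F},
      ContDiff ℝ 2 f → (∀ y, HasDerivAt f (deriv f y) y) ∧ ContDiff ℝ 1 (deriv f) := fun hf =>
    ⟨fun y => (hf.differentiable (by norm_num) y).hasDerivAt,
      (contDiff_succ_iff_deriv.1 (by simpa [one_add_one_eq_two] using hf)).2.2⟩
  obtain ⟨hUd, hU'⟩ := hsucc hU
  obtain ⟨hud, hu'⟩ := hsucc hu
  obtain ⟨hvd, hv'⟩ := hsucc hv
  have hfield : ∀ ε, ContDiff ℝ 1 (Function.uncurry (perturbedVelocity U uhat vhat k ω ε)) :=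
    contDiff_perturbedVelocity k ω hU1 (hu.of_le (by norm_num)) (hv.of_le (by norm_num))
  obtain ⟨X, Y, hX, hY, heq⟩ := exists_contDiffAt_motion h01 (U := ⟨U, hU.continuous⟩)
    (uhat := ⟨uhat, hu.continuous⟩) (vhat := ⟨vhat, hv.continuous⟩) k ω hU hu hv x₀
  have htraj := heq.mono fun q hq => isTrajectory_of_integral_eq h01 hq.1 hq.2
  -- the position at the final time
  let τ : Icc t₀ (t₀ + T) := projIcc t₀ (t₀ + T) h01 (t₀ + T)
  have hflow : ∀ᶠ q in 𝓝 ((0 : ℝ), x₀),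
      flowMap (perturbedVelocity U uhat vhat k ω q.1) t₀ (t₀ + T) q.2 = !₂[X q τ, Y q τ] :=
    htraj.mono fun q hq => hq.flowMap_eq (hfield q.1) (right_mem_Icc.2 h01)
  have hε : Tendsto (fun ε : ℝ => (ε, x₀)) (𝓝 0) (𝓝 (0, x₀)) :=
    (Continuous.prodMk_left x₀).tendsto (0 : ℝ)
  have hXε : ContDiffAt ℝ 2 (fun ε => X (ε, x₀)) 0 :=
    ContDiffAt.comp (0 : ℝ) (g := X) hX (by fun_prop)
  have hYε : ContDiffAt ℝ 2 (fun ε => Y (ε, x₀)) 0 :=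
    ContDiffAt.comp (0 : ℝ) (g := Y) hY (by fun_prop)
  obtain ⟨hA, hAY⟩ := solvesResponseIVP_deriv h01 (U' := ⟨deriv U, hU'.continuous⟩)
    (uhat' := ⟨deriv uhat, hu'.continuous⟩) (vhat' := ⟨deriv vhat, hv'.continuous⟩) k ω hUd hud hvd
    (hXε.differentiableAt (by norm_num)) (hYε.differentiableAt (by norm_num)) (hε.eventually heq)
  have hexpl : g k ω.re ω.im (U (x₀ 1)) ≠ 0 →
      !₂[deriv (fun ε => X (ε, x₀)) 0 τ, deriv (fun ε => Y (ε, x₀)) 0 τ]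
        = explicitResponse U uhat vhat k ω t₀ T x₀ := fun hg => by
    simpa [τ] using hA.eqOn hU1 (solvesResponseIVP_explicitResponse hU1 uhat vhat k ω t₀ _ x₀ hg)
      (right_mem_Icc.2 h01)
  refine ⟨?_, fun t ht => flowMap_baseVelocity hU1 x₀ ht.1,
    ⟨_, hA, fun B hB => hB.eqOn hU1 hA, ?_, hexpl⟩, ?_⟩
  · have hle : 𝓝[>] (0 : ℝ) ×ˢ 𝓝 x₀ ≤ 𝓝 ((0 : ℝ), x₀) := by
      rw [nhds_prod_eq]
      exact prod_mono nhdsWithin_le_nhds le_rfl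
    filter_upwards [hle htraj] with q hq
    have hq' := hq.isTrajectory_flowMap (hfield q.1) h01
    exact ⟨hq', fun γ hγ => hγ.eqOn (hfield q.1) hq'⟩
  · refine IsBigO.mono ?_ nhdsWithin_le_nhds
    have heval : ∀ {G : ℝ → C(Icc t₀ (t₀ + T), ℝ)}, ContDiffAt ℝ 2 G 0 →
        (fun ε => G ε τ - (G 0 τ + ε * deriv G 0 τ)) =O[𝓝 0] fun ε : ℝ => ε ^ 2 := fun hG =>
      ((ContinuousMap.evalCLM ℝ τ : C(Icc t₀ (t₀ + T), ℝ) →L[ℝ] ℝ).isBigO_comp _ _).trans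
        (isBigO_sub_sub_deriv hG)
    have hbase := hflow.self_of_nhds
    simp only [perturbedVelocity_zero] at hbase
    refine (isBigO_plane (heval hXε) (heval hYε)).congr' ?_ EventuallyEq.rfl
    filter_upwards [hε.eventually hflow] with ε h1
    rw [h1, hbase]
    ext i
    fin_cases i <;> simp [τ]
  · intro r s₀ hr hr0 hr1 hrκ
    have hrd := hr.differentiableAt (by norm_num)
    have hρ₁ : deriv (fun s => r s 0) s₀ = 1 := by
      rw [← deriv_apply hrd, hr1]; simp
    have hσ₁ : deriv (fun s => r s 1) s₀ = 0 := by
      rw [← deriv_apply hrd, hr1]; simp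
    have hσ₂ : deriv (deriv fun s => r s 1) s₀ = 0 := by
      have := hrκ
      rw [curvature_eq hr, hρ₁, hσ₁] at this
      simpa using this
    have hρ : ContDiffAt ℝ 2 (fun s => r s 0) s₀ :=
      (EuclideanSpace.proj 0 : Plane →L[ℝ] ℝ).contDiff.contDiffAt.comp s₀ hr
    have hσ : ContDiffAt ℝ 2 (fun s => r s 1) s₀ :=
      (EuclideanSpace.proj 1 : Plane →L[ℝ] ℝ).contDiff.contDiffAt.comp s₀ hr
    have hfam : ContDiffAt ℝ 2 (fun q : ℝ × ℝ => (q.1, r q.2)) (0, s₀) :=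
      contDiffAt_fst.prodMk (ContDiffAt.comp (0, s₀) (g := r) hr contDiffAt_snd)
    have hfamt : Tendsto (fun q : ℝ × ℝ => (q.1, r q.2)) (𝓝 (0, s₀)) (𝓝 (0, x₀)) := by
      simpa only [hr0] using hfam.continuousAt.tendsto
    have hXs : ContDiffAt ℝ 2 (fun q : ℝ × ℝ => X (q.1, r q.2)) (0, s₀) :=
      ContDiffAt.comp (0, s₀) (g := X) (by simpa only [hr0] using hX) hfam
    have hYs : ContDiffAt ℝ 2 (fun q : ℝ × ℝ => Y (q.1, r q.2)) (0, s₀) :=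
      ContDiffAt.comp (0, s₀) (g := Y) (by simpa only [hr0] using hY) hfam
    obtain ⟨oX₁, oX₂, oY₁, oY₂⟩ := isBigO_family h01 (U' := ⟨deriv U, hU'.continuous⟩)
      (vhat' := ⟨deriv vhat, hv'.continuous⟩) k ω hU hu hv hUd hU' hvd hv' hρ hσ hρ₁ rfl hσ₁ hσ₂
      hXs hYs (hfamt.eventually heq) rfl rfl
    rw [hr0] at oY₁ oY₂
    -- the components of the advected curve and their derivatives
    have hcurve : ∀ᶠ ε in 𝓝 (0 : ℝ), ∀ᶠ s in 𝓝 s₀,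
        (flowMap (perturbedVelocity U uhat vhat k ω ε) t₀ (t₀ + T) ∘ r) s
          = !₂[X (ε, r s) τ, Y (ε, r s) τ] :=
      (hfamt.eventually hflow).curry_nhds
    have hcomp : ∀ᶠ ε in 𝓝 (0 : ℝ),
        let c := flowMap (perturbedVelocity U uhat vhat k ω ε) t₀ (t₀ + T) ∘ r
        ContDiffAt ℝ 2 c s₀ ∧
        (deriv (fun s => c s 0) s₀ = partialSnd (fun q => X (q.1, r q.2)) (ε, s₀) τ ∧
          deriv (deriv fun s => c s 0) s₀
            = partialSnd (partialSnd fun q => X (q.1, r q.2)) (ε, s₀) τ) ∧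
        (deriv (fun s => c s 1) s₀ = partialSnd (fun q => Y (q.1, r q.2)) (ε, s₀) τ ∧
          deriv (deriv fun s => c s 1) s₀
            = partialSnd (partialSnd fun q => Y (q.1, r q.2)) (ε, s₀) τ) := by
      filter_upwards [hcurve, eventually_deriv_slice hXs τ, eventually_deriv_slice hYs τ]
        with ε h1 h2 h3
      intro c
      obtain ⟨a1, a2⟩ := h2 (fun s => c s 0) (h1.mono fun s hs =>
        congrArg (fun p : Plane => p 0) hs)
      obtain ⟨b1, b2⟩ := h3 (fun s => c s 1) (h1.mono fun s hs =>
        congrArg (fun p : Plane => p 1) hs)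
      refine ⟨contDiffAt_euclidean.2 fun i => ?_, a2, b2⟩
      fin_cases i
      exacts [a1, b1]
    have hval : ∀ {G : ℝ → C(Icc t₀ (t₀ + T), ℝ)} {φ : ℝ → ℝ}, G =O[𝓝 0] φ →
        (fun ε => G ε τ) =O[𝓝 0] φ := fun hG =>
      ((ContinuousMap.evalCLM ℝ τ : C(Icc t₀ (t₀ + T), ℝ) →L[ℝ] ℝ).isBigO_comp _ _).trans hG
    have ox₁ : (fun ε => partialSnd (fun q => X (q.1, r q.2)) (ε, s₀) τ - 1)
        =O[𝓝 0] fun ε : ℝ => ε := by simpa using hval oX₁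
    constructor
    · have ht : ∀ᶠ ε in 𝓝 (0 : ℝ), partialSnd (fun q => X (q.1, r q.2)) (ε, s₀) τ ≠ 0 := by
        have := (ox₁.trans_tendsto tendsto_id).add_const 1
        simp only [sub_add_cancel, zero_add] at this
        exact this.eventually_ne one_ne_zero
      filter_upwards [nhdsWithin_le_nhds hcomp, nhdsWithin_le_nhds ht] with ε h1 h2
      refine ⟨h1.1, fun h0 => h2 ?_⟩
      rw [← h1.2.1.1, ← deriv_apply (h1.1.differentiableAt (by norm_num)), h0]
      simp
    · intro hg
      refine IsBigO.mono ?_ nhdsWithin_le_nhds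
      have hrate : curvatureRate k ω t₀ T (x₀ 0) (U (x₀ 1)) (vhat (x₀ 1))
          = k ^ 2 * deriv (fun ε => Y (ε, x₀)) 0 τ := by
        have := congrArg (fun p : Plane => p 1) (hexpl hg)
        simp only [explicitResponse, PiLp.toLp_apply, Matrix.cons_val_one, Matrix.cons_val_zero]
          at this
        rw [this]
        simp only [curvatureRate, f₅, f₆, g]
        ring
      refine (isBigO_curvature ox₁ (by simpa using hval oX₂) (by simpa using hval oY₁)
        (by simpa using hval oY₂) (m := k ^ 2)).congr' ?_ EventuallyEq.rfl
      filter_upwards [hcomp] with ε hc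
      obtain ⟨hc0, ⟨hx1, hx2⟩, hy1, hy2⟩ := hc
      rw [curvatureChange, hrκ, curvature_eq hc0, hx1, hx2, hy1, hy2, hrate, hAY, sub_zero]
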